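/- Let $f:\mathbb R^n\to(-\infty,+\infty]$ and $g:\mathbb R^m\to(-\infty,+\infty]$ be proper, convex and lower semicontinuous, let $f_2:\mathbb R^n\to\mathbb R$ be convex and differentiable with $L_f$-Lipschitz gradient, let $A$ be a real $m\times n$ matrix, and suppose that $g$ is Lipschitz continuous on its domain $\operatorname{dom} g=\{v: g(v)<+\infty\}$. Let $(x_*,y_*)$ be a saddle point of the Lagrangian $L(x,y)=f(x)+f_2(x)+\langle Ax,y\rangle-g^*(y)$ (minimized in $x$, maximized in $y$), where $g^*$ is the Fenchel conjugate of $g$, and put $P^*=f(x_*)+f_2(x_*)+g(Ax_*)$. Let $r>1$ and $\delta>0$ with $\delta r<1$. Let $z_k=(x_k,y_k)$ be generated, from an arbitrary $z_0\in\mathbb R^{n+m}$, by the Tri-PD form of the primal-dual hybrid gradient method with step sizes $\tau_k,\sigma_k$: $$\bar x_{k+1}=\operatorname{prox}_{\tau_k f}\bigl(x_k-\tau_k\nabla f_2(x_k)-\tau_kA^\top y_k\bigr),\quad y_{k+1}=\operatorname{prox}_{\sigma_k g^*}\bigl(y_k+\sigma_kA\bar x_{k+1}\bigr),\quad x_{k+1}=\bar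 x_{k+1}-\tau_kA^\top(y_{k+1}-y_k).$$ The initial step sizes satisfy $\tau_0,\sigma_0>0$ and $\sigma_0\tau_0\|A\|^2<1$, and $\tau_kL_f<2$ for all $k$. Let $R_k=\frac1{\tau_k}\|x_{k+1}-x_k\|^2+\frac1{\sigma_k}\|y_{k+1}-y_k\|^2$ denote the squared residual of iteration $k$. After each iteration $k$, either the step sizes are kept, $(\tau_{k+1},\sigma_{k+1})=(\tau_k,\sigma_k)$, or they are changed to $(r\tau_k,\sigma_k/r)$ or to $(\tau_k/r,r\sigma_k)$. With $s$ the index from which on the current step sizes have been in use ($s=0$ as long as no change has occurred), a change after iteration $k$ is allowed only if $s=0$ or $R_k\le\delta R_{s-1}$, that is, only if the squared residual has dropped at least by the factor $\delta$ since the previous change. Apart from this, whether and in which direction the step sizes are changed is decided arbitrarily (for instance by a rule that estimates the convergence rate), and the number of changes may be infinite. Then the feasibility gap and the optimality gap converge to $0$: with $w_{k+1}$ the projection of $A\bar x_{k+1}$ on $\operatorname{dom} g$, $$\lim_{k\to\infty}\operatorname{dist}(A\bar x_{k+1},\operatorname{dom} g)=0\qquad\text{and}\qquad\lim_{k\to\infty}\bigl(f(\bar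 x_{k+1})+f_2(\bar x_{k+1})+g(w_{k+1})-P^*\bigr)=0 .$$ -/

import Mathlib

open Filter Topology
open scoped NNReal InnerProductSpace

noncomputable section

namespace TriPD

/-- The effective domain of an extended-real-valued function. -/
def effDom {E : Type*} (f : E → EReal) : Set E := {x | f x ≠ ⊤}

/-- Proper convex lower semicontinuous functions with values in `(-∞, +∞]`;
convexity is convexity of the epigraph. -/
structure IsProperConvexLsc {E : Type*} [NormedAddCommGroup E] [NormedSpace ℝ E]
    (f : E → EReal) : Prop where
  ne_bot : ∀ x, f x ≠ ⊥
  nonempty_dom : (effDom f).Nonempty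
  convex_epi : Convex ℝ {p : E × ℝ | f p.1 ≤ (p.2 : EReal)}
  lsc : LowerSemicontinuous f

/-- The Fenchel conjugate `g*(y) = sup_v ⟨v, y⟩ - g(v)`. -/
def fenchelConj {F : Type*} [NormedAddCommGroup F] [InnerProductSpace ℝ F]
    (g : F → EReal) (y : F) : EReal :=
  ⨆ v : F, ((⟪v, y⟫_ℝ : ℝ) : EReal) - g v

/-- `p = prox_{γ f}(v)`: the point `p` minimizes `u ↦ f(u) + ‖u - v‖² / (2γ)`. -/
def IsProx {E : Type*} [NormedAddCommGroup E] (γ : ℝ) (f : E → EReal) (v p : E) : Prop :=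
  ∀ u, f p + ((‖p - v‖ ^ 2 / (2 * γ) : ℝ) : EReal) ≤ f u + ((‖u - v‖ ^ 2 / (2 * γ) : ℝ) : EReal)

/-- `w` is a metric projection of `v` on the set `S`. -/
def IsProj {E : Type*} [NormedAddCommGroup E] (S : Set E) (v w : E) : Prop :=
  w ∈ S ∧ dist v w = Metric.infDist v S

/-- The squared norm `‖(u, v)‖²_V = ‖u‖² / τ + ‖v‖² / σ` of the Tri-PD algorithm. -/
def sqNormV {E F : Type*} [NormedAddCommGroup E] [NormedAddCommGroup F]
    (τ σ : ℝ) (u : E) (v : F) : ℝ :=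
  ‖u‖ ^ 2 / τ + ‖v‖ ^ 2 / σ

section

variable {E F : Type*}
  [NormedAddCommGroup E] [InnerProductSpace ℝ E] [CompleteSpace E]
  [NormedAddCommGroup F] [InnerProductSpace ℝ F] [CompleteSpace F]

/-- The Lagrangian `L(x, y) = f(x) + f₂(x) + ⟨A x, y⟩ - g*(y)`. -/
def lagrangian (f : E → EReal) (f₂ : E → ℝ) (g : F → EReal) (A : E →L[ℝ] F)
    (x : E) (y : F) : EReal :=
  f x + (f₂ x : EReal) + ((⟪A x, y⟫_ℝ : ℝ) : EReal) - fenchelConj g y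

/-- `(xs, ys)` is a saddle point of the Lagrangian (minimized in `x`, maximized in `y`). The two
domain conditions keep indeterminate differences `∞ - ∞` out of the inequalities. -/
def IsSaddlePoint (f : E → EReal) (f₂ : E → ℝ) (g : F → EReal) (A : E →L[ℝ] F)
    (xs : E) (ys : F) : Prop :=
  xs ∈ effDom f ∧ ys ∈ effDom (fenchelConj g) ∧
    (∀ y, lagrangian f f₂ g A xs y ≤ lagrangian f f₂ g A xs ys) ∧
    (∀ x, lagrangian f f₂ g A xs ys ≤ lagrangian f f₂ g A x ys)

/-- The primal objective in which the argument of `g` is the separate variable `w`: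
`f(x) + f₂(x) + g(w)`. -/
def objective (f : E → EReal) (f₂ : E → ℝ) (g : F → EReal) (x : E) (w : F) : EReal :=
  f x + (f₂ x : EReal) + g w

/-- The squared residual `‖z_{k+1} - z_k‖²_V`, in the norm of the step sizes that were used to
compute `z_{k+1}` from `z_k`. -/
def sqResidual (x : ℕ → E) (y : ℕ → F) (τ σ : ℕ → ℝ) (k : ℕ) : ℝ :=
  sqNormV (τ k) (σ k) (x (k + 1) - x k) (y (k + 1) - y k)

/-- A run of Tri-PD with adaptive step sizes, without residual-balancing warm-up.

`z_k = (x k, y k)` are the iterates, `xbar (k + 1)` is the intermediate primal point of iteration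
`k`, `τ k` and `σ k` are the step sizes of iteration `k`, and `s k` is the index from which on the
current step sizes have been in use. After iteration `k` the step sizes are either kept, or one of
them is multiplied by `r` and the other one divided by `r`. The latter is allowed only if the
squared residual of iteration `k` is at most `δ` times the one at which the current step sizes were
adopted, namely `‖z_s - z_{s-1}‖²` in the norm of iteration `s - 1`, where `s = s k`. (If the step
sizes are still the initial ones, `s k = 0`, there is no such earlier residual and nothing is
required.)  Whether an allowed change is carried out, and in which direction, is the business of the
rate estimator; every sequence of such decisions is a run, so in particular the decisions of any
given estimator are covered. -/
structure IsAdaptiveRun (f : E → EReal) (f₂ : E → ℝ) (g : F → EReal) (A : E →L[ℝ] F)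
    (r δ : ℝ) (x xbar : ℕ → E) (y : ℕ → F) (τ σ : ℕ → ℝ) (s : ℕ → ℕ) : Prop where
  tau_pos : 0 < τ 0
  sigma_pos : 0 < σ 0
  s_zero : s 0 = 0
  xbar_step : ∀ k, IsProx (τ k) f
    (x k - τ k • gradient f₂ (x k) - τ k • (ContinuousLinearMap.adjoint A) (y k)) (xbar (k + 1))
  y_step : ∀ k, IsProx (σ k) (fenchelConj g) (y k + σ k • A (xbar (k + 1))) (y (k + 1))
  x_step : ∀ k, x (k + 1) =
    xbar (k + 1) - τ k • (ContinuousLinearMap.adjoint A) (y (k + 1) - y k)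
  update : ∀ k,
    (τ (k + 1) = τ k ∧ σ (k + 1) = σ k ∧ s (k + 1) = s k) ∨
    ((s k ≠ 0 → sqResidual x y τ σ k ≤ δ * sqResidual x y τ σ (s k - 1)) ∧
      s (k + 1) = k + 1 ∧
      ((τ (k + 1) = τ k * r ∧ σ (k + 1) = σ k * r⁻¹) ∨
       (τ (k + 1) = τ k * r⁻¹ ∧ σ (k + 1) = σ k * r)))

end

end TriPD

end

namespace TriPD

/-! For fixed step sizes one iteration is nonexpansive in the norm ‖·‖_V, with a strict decrease
controlled by the displacement. This follows from monotonicity of the two subdifferentials and a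
three-point cocoercivity of ∇f₂ (`IsStep.contraction`). Hence the squared residual R_k does not
increase while the step sizes are kept, and the squared distance D_k to the saddle point never
increases except through a change of norm.

Let N be the number of changes before iteration k. Three quantities are tracked against N: R_k ≤ K
δ^N R_0 (`sqResidual_le`), D_k ≤ r^N D_0 (`sqNormV_sub_saddle_le`), and 1/σ_k ≤ r^N/σ_0
(`sigma_zero_le`). A change can inflate the residual by a factor depending on r, but the drop test
compares with the residual before the previous change, so these factors do not accumulate. Thus ε_k
= R_k r^N → 0: by δr < 1 if N is unbounded, and by telescoping D_k once the step sizes are constant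
otherwise (`tendsto_sqResidual_mul`).

The dual step yields a point v_k ∈ dom g with y_{k+1} ∈ ∂g(v_k) and ‖v_k - A x̄_{k+1}‖ ≤ √(ε_k/σ_0).
The gap at v_k is bounded on both sides by terms in √ε_k and ε_k, using R_k D_k ≤ ε_k D_0; Lipschitz
continuity of g then replaces v_k by the projection. -/

/-- `h` is a subgradient of `f` at the point `p` of its domain. -/
def IsSubgradient {E : Type*} [NormedAddCommGroup E] [InnerProductSpace ℝ E]
    (f : E → EReal) (p h : E) : Prop :=
  f p ≠ ⊤ ∧ ∀ u, f u ≠ ⊤ → (f p).toReal + ⟪h, u - p⟫_ℝ ≤ (f u).toReal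

/-! ### Subgradients, proximal points and Fenchel conjugates. -/

section Subgradient

variable {E F : Type*}
  [NormedAddCommGroup E] [InnerProductSpace ℝ E]
  [NormedAddCommGroup F] [InnerProductSpace ℝ F]

theorem IsSubgradient.inner_nonneg {f : E → EReal} {p p' h h' : E}
    (H : IsSubgradient f p h) (H' : IsSubgradient f p' h') : 0 ≤ ⟪h - h', p - p'⟫_ℝ := by
  have h1 := H.2 p' H'.1
  have h2 := H'.2 p H.1
  rw [← neg_sub p p', inner_neg_right] at h1
  rw [inner_sub_left]
  linarith

theorem toReal_segment_le {f : E → EReal} (hbot : ∀ x, f x ≠ ⊥)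
    (hconv : Convex ℝ {p : E × ℝ | f p.1 ≤ (p.2 : EReal)}) {p u : E} (hp : f p ≠ ⊤)
    (hu : f u ≠ ⊤) {t : ℝ} (ht : 0 ≤ t) (ht1 : t ≤ 1) :
    f (p + t • (u - p)) ≠ ⊤ ∧
      (f (p + t • (u - p))).toReal ≤ (f p).toReal + t * ((f u).toReal - (f p).toReal) := by
  have h1 : (p, (f p).toReal) ∈ {p : E × ℝ | f p.1 ≤ (p.2 : EReal)} :=
    EReal.le_coe_toReal hp
  have h2 : (u, (f u).toReal) ∈ {p : E × ℝ | f p.1 ≤ (p.2 : EReal)} :=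
    EReal.le_coe_toReal hu
  have h3 := hconv.add_smul_sub_mem h1 h2 ⟨ht, ht1⟩
  have h4 : f (p + t • (u - p)) ≤
      (((f p).toReal + t * ((f u).toReal - (f p).toReal) : ℝ) : EReal) := by
    simpa using h3
  have h5 : f (p + t • (u - p)) ≠ ⊤ := ne_top_of_le_ne_top (EReal.coe_ne_top _) h4
  refine ⟨h5, ?_⟩
  rw [← EReal.coe_le_coe_iff, EReal.coe_toReal h5 (hbot _)]
  exact h4

/-- Fermat's rule for a sum of a convex and a differentiable function. -/
theorem isSubgradient_of_min [CompleteSpace E] {f : E → EReal} (hbot : ∀ x, f x ≠ ⊥)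
    (hconv : Convex ℝ {p : E × ℝ | f p.1 ≤ (p.2 : EReal)}) {φ : E → ℝ} {p h : E}
    (hp : f p ≠ ⊤) (hφ : HasGradientAt φ h p)
    (hmin : ∀ u, f u ≠ ⊤ → (f p).toReal + φ p ≤ (f u).toReal + φ u) :
    IsSubgradient f p (-h) := by
  refine ⟨hp, fun u hu => ?_⟩
  have hl : HasDerivAt (fun t : ℝ => p + t • (u - p)) (u - p) 0 := by
    simpa using ((hasDerivAt_id (0 : ℝ)).smul_const (u - p)).const_add p
  have hd : HasDerivAt (fun t : ℝ => φ (p + t • (u - p))) ⟪h, u - p⟫_ℝ 0 := by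
    have h1 : HasFDerivAt φ ((InnerProductSpace.toDual ℝ E) h) (p + (0 : ℝ) • (u - p)) := by
      simpa using hφ.hasFDerivAt
    exact (h1.comp_hasDerivAt (0 : ℝ) hl).congr_deriv (by simp)
  have hs := hd.tendsto_slope_zero_right
  -- Along the segment from p to u, minimality and convexity of f bound every difference quotient of
  -- φ below by f(p) - f(u).
  have hge : (f p).toReal - (f u).toReal ≤ ⟪h, u - p⟫_ℝ := by
    refine ge_of_tendsto hs ?_
    filter_upwards [Ioo_mem_nhdsGT (zero_lt_one' ℝ)] with t ht
    obtain ⟨h1, h2⟩ := toReal_segment_le hbot hconv hp hu ht.1.le ht.2.le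
    have h3 := hmin _ h1
    simp only [zero_add, zero_smul, add_zero, smul_eq_mul]
    rw [inv_mul_eq_div, le_div_iff₀ ht.1]
    linarith
  rw [inner_neg_left]
  linarith

theorem isSubgradient_of_isProx [CompleteSpace E] {f : E → EReal} (hbot : ∀ x, f x ≠ ⊥)
    (hconv : Convex ℝ {p : E × ℝ | f p.1 ≤ (p.2 : EReal)}) (hne : (effDom f).Nonempty)
    {γ : ℝ} {v p : E} (hp : IsProx γ f v p) : IsSubgradient f p (γ⁻¹ • (v - p)) := by
  have hpt : f p ≠ ⊤ := by
    obtain ⟨u, hu⟩ := hne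
    intro htop
    have h1 := hp u
    rw [htop, EReal.top_add_coe, top_le_iff] at h1
    exact EReal.add_ne_top hu (EReal.coe_ne_top _) h1
  have hg : HasGradientAt (fun u : E => ‖u - v‖ ^ 2 / (2 * γ)) (γ⁻¹ • (p - v)) p := by
    rw [hasGradientAt_iff_hasFDerivAt]
    have h1 : HasFDerivAt (fun u : E => u - v) (ContinuousLinearMap.id ℝ E) p :=
      (hasFDerivAt_id p).sub_const v
    have h2 := (h1.norm_sq).mul_const ((2 * γ)⁻¹)
    simp only [← div_eq_mul_inv] at h2
    refine h2.congr_fderiv ?_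
    ext w
    simp
    ring
  have := isSubgradient_of_min hbot hconv hpt hg fun u hu => by
    have h1 := hp u
    rw [← EReal.coe_toReal hpt (hbot p), ← EReal.coe_toReal hu (hbot u)] at h1
    exact_mod_cast h1
  rwa [← smul_neg, neg_sub] at this

theorem le_fenchelConj (g : F → EReal) (u y : F) :
    ((⟪u, y⟫_ℝ : ℝ) : EReal) - g u ≤ fenchelConj g y :=
  le_iSup (fun v : F => ((⟪v, y⟫_ℝ : ℝ) : EReal) - g v) u

theorem fenchelConj_le_coe_iff {g : F → EReal} (hbot : ∀ x, g x ≠ ⊥) {y : F} {c : ℝ} :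
    fenchelConj g y ≤ c ↔ ∀ u, g u ≠ ⊤ → ⟪u, y⟫_ℝ - (g u).toReal ≤ c := by
  rw [fenchelConj, iSup_le_iff]
  refine forall_congr' fun u => ?_
  by_cases hu : g u = ⊤
  · simp [hu]
  · simp only [ne_eq, hu, not_false_eq_true, forall_const]
    rw [← EReal.coe_le_coe_iff, EReal.coe_sub, EReal.coe_toReal hu (hbot u)]

theorem inner_sub_toReal_le_fenchelConj {g : F → EReal} (hbot : ∀ x, g x ≠ ⊥) {u y : F}
    (hu : g u ≠ ⊤) (hy : fenchelConj g y ≠ ⊤) :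
    ⟪u, y⟫_ℝ - (g u).toReal ≤ (fenchelConj g y).toReal :=
  (fenchelConj_le_coe_iff hbot).1 (EReal.le_coe_toReal hy) u hu

theorem fenchelConj_ne_bot {g : F → EReal} (hbot : ∀ x, g x ≠ ⊥) (hne : (effDom g).Nonempty)
    (y : F) : fenchelConj g y ≠ ⊥ := by
  obtain ⟨u, hu⟩ := hne
  intro h
  have h1 := le_fenchelConj g u y
  rw [h, ← EReal.coe_toReal hu (hbot u), ← EReal.coe_sub, le_bot_iff] at h1
  exact EReal.coe_ne_bot _ h1

theorem convex_epi_fenchelConj {g : F → EReal} (hbot : ∀ x, g x ≠ ⊥) :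
    Convex ℝ {p : F × ℝ | fenchelConj g p.1 ≤ (p.2 : EReal)} := by
  rintro ⟨y, c⟩ hy ⟨y', c'⟩ hy' a b ha hb hab
  simp only [Set.mem_ofPred_eq, Prod.smul_mk, Prod.mk_add_mk, smul_eq_mul] at hy hy' ⊢
  rw [fenchelConj_le_coe_iff hbot] at hy hy' ⊢
  intro u hu
  have h1 := mul_le_mul_of_nonneg_left (hy u hu) ha
  have h2 := mul_le_mul_of_nonneg_left (hy' u hu) hb
  rw [inner_add_right, inner_smul_right, inner_smul_right]
  have h3 : (g u).toReal = a * (g u).toReal + b * (g u).toReal := by rw [← add_mul, hab, one_mul]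
  linarith

theorem IsProperConvexLsc.isClosed_epi {g : F → EReal} (hg : IsProperConvexLsc g) :
    IsClosed {p : F × ℝ | g p.1 ≤ (p.2 : EReal)} := by
  have h := hg.lsc.isClosed_epigraph
  exact h.preimage (f := fun p : F × ℝ => (p.1, (p.2 : EReal)))
    (continuous_fst.prodMk (continuous_coe_real_ereal.comp continuous_snd))

/-- Subgradients of the conjugate `g*` are inverted by `g` (Fenchel-Moreau). -/
theorem IsSubgradient.of_fenchelConj [CompleteSpace F] {g : F → EReal} (hg : IsProperConvexLsc g)
    {y v : F} (H : IsSubgradient (fenchelConj g) y v) : IsSubgradient g v y := by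
  have hbot := hg.ne_bot
  -- The missing half of the Fenchel-Young equality. If it fails, a hyperplane (h, β) strictly
  -- separates the point from the closed epigraph.
  have key : g v ≤ ((⟪v, y⟫_ℝ - (fenchelConj g y).toReal : ℝ) : EReal) := by
    by_contra hcon
    obtain ⟨φ, α, hφ1, hφ2⟩ := geometric_hahn_banach_closed_point
      (x := (v, ⟪v, y⟫_ℝ - (fenchelConj g y).toReal)) hg.convex_epi hg.isClosed_epi hcon
    set β : ℝ := φ (0, 1) with hβ
    set h : F := (InnerProductSpace.toDual ℝ F).symm
      (φ.comp (ContinuousLinearMap.inl ℝ F ℝ)) with hh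
    have hφ : ∀ u t, φ (u, t) = ⟪h, u⟫_ℝ + t * β := by
      intro u t
      have h1 : (u, t) = (u, (0 : ℝ)) + t • ((0 : F), (1 : ℝ)) := by simp
      rw [h1, map_add, map_smul, hh, InnerProductSpace.toDual_symm_apply]
      simp [hβ]
    have hle : ∀ u, g u ≠ ⊤ → ⟪h, u⟫_ℝ + (g u).toReal * β < α := fun u hu => by
      rw [← hφ]
      exact hφ1 (u, (g u).toReal) (EReal.le_coe_toReal hu)
    rw [hφ] at hφ2
    -- The epigraph is unbounded upwards.
    have hβ0 : β ≤ 0 := by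
      obtain ⟨u, hu⟩ := hg.nonempty_dom
      by_contra! hpos
      have h1 := hle u hu
      have h2 := hφ1 (u, (g u).toReal + (α - ⟪h, u⟫_ℝ - (g u).toReal * β) / β) (by
        refine (EReal.le_coe_toReal hu).trans (EReal.coe_le_coe_iff.2 ?_)
        have : 0 ≤ (α - ⟪h, u⟫_ℝ - (g u).toReal * β) / β := div_nonneg (by linarith) hpos.le
        linarith)
      rw [hφ, add_mul, div_mul_cancel₀ _ hpos.ne'] at h2
      linarith
    rcases hβ0.lt_or_eq with hneg | hzero
    -- A non-vertical hyperplane is an affine minorant of g with slope γ⁻¹h. The bound it gives on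
    -- g* at γ⁻¹h contradicts the subgradient inequality at y.
    · set γ := -β with hγ
      have hγ0 : 0 < γ := by linarith
      have h1 : fenchelConj g (γ⁻¹ • h) ≤ ((γ⁻¹ * α : ℝ) : EReal) := by
        rw [fenchelConj_le_coe_iff hbot]
        intro u hu
        have h2 := mul_le_mul_of_nonneg_left (hle u hu).le (inv_pos.2 hγ0).le
        have h3 : γ⁻¹ * (⟪h, u⟫_ℝ + (g u).toReal * β) = γ⁻¹ * ⟪h, u⟫_ℝ - (g u).toReal := by
          have : β = -γ := by simp [hγ]
          rw [this]; field_simp; ring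
        rw [inner_smul_right, real_inner_comm]
        linarith
      have htop := ne_top_of_le_ne_top (EReal.coe_ne_top _) h1
      have h2 := H.2 _ htop
      have h3 := EReal.toReal_le_toReal h1 (fenchelConj_ne_bot hbot hg.nonempty_dom _)
        (EReal.coe_ne_top _)
      rw [EReal.toReal_coe] at h3
      rw [inner_sub_right, inner_smul_right, real_inner_comm] at h2
      have h4 := mul_lt_mul_of_pos_left hφ2 (inv_pos.2 hγ0)
      have h5 : γ⁻¹ * (⟪h, v⟫_ℝ + (⟪v, y⟫_ℝ - (fenchelConj g y).toReal) * β) =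
          γ⁻¹ * ⟪h, v⟫_ℝ - (⟪v, y⟫_ℝ - (fenchelConj g y).toReal) := by
        have : β = -γ := by simp [hγ]
        rw [this]; field_simp; ring
      linarith
    -- A vertical hyperplane gives g*(y + h) ≤ g*(y) + α, while the subgradient v forces g*(y + h) ≥
    -- g*(y) + ⟨h, v⟩ > g*(y) + α.
    · rw [hzero] at hle hφ2
      have h1 : fenchelConj g (y + h) ≤ (((fenchelConj g y).toReal + α : ℝ) : EReal) := by
        rw [fenchelConj_le_coe_iff hbot]
        intro u hu
        have h2 := inner_sub_toReal_le_fenchelConj hbot hu H.1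
        have h3 := hle u hu
        rw [inner_add_right, real_inner_comm h u]
        linarith
      have htop := ne_top_of_le_ne_top (EReal.coe_ne_top _) h1
      have h2 := H.2 _ htop
      have h3 := EReal.toReal_le_toReal h1 (fenchelConj_ne_bot hbot hg.nonempty_dom _)
        (EReal.coe_ne_top _)
      rw [EReal.toReal_coe] at h3
      rw [add_sub_cancel_left, real_inner_comm] at h2
      linarith
  have hv : g v ≠ ⊤ := ne_top_of_le_ne_top (EReal.coe_ne_top _) key
  refine ⟨hv, fun u hu => ?_⟩
  have h1 := inner_sub_toReal_le_fenchelConj hbot hu H.1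
  have h2 := EReal.toReal_le_toReal key (hbot v) (EReal.coe_ne_top _)
  rw [EReal.toReal_coe] at h2
  rw [inner_sub_right, real_inner_comm u y, real_inner_comm v y]
  linarith

/-- Lipschitz continuity bounds g along a convergent sequence of the domain, and the closed epigraph
passes this bound to the limit. Closedness is what makes projections on dom g exist. -/
theorem isClosed_effDom {g : F → EReal} (hg : IsProperConvexLsc g) {M : ℝ≥0}
    (hM : LipschitzOnWith M (fun v => (g v).toReal) (effDom g)) : IsClosed (effDom g) := by
  refine isClosed_of_closure_subset fun v hv => ?_
  obtain ⟨u, hu, hlim⟩ := mem_closure_iff_seq_limit.1 hv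
  have hb : ∀ᶠ k in atTop, g (u k) ≤ (((g (u 0)).toReal + M * (dist v (u 0) + 1) : ℝ) : EReal) := by
    have h1 : ∀ᶠ k in atTop, dist (u k) (u 0) < dist v (u 0) + 1 :=
      (hlim.dist tendsto_const_nhds).eventually_lt_const (by linarith)
    filter_upwards [h1] with k hk
    refine (EReal.le_coe_toReal (hu k)).trans (EReal.coe_le_coe_iff.2 ?_)
    have h2 := hM.dist_le_mul (u k) (hu k) (u 0) (hu 0)
    rw [Real.dist_eq] at h2
    have h3 := (le_abs_self _).trans h2
    have h4 := mul_le_mul_of_nonneg_left hk.le M.coe_nonneg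
    linarith
  have hmem : (v, (g (u 0)).toReal + M * (dist v (u 0) + 1)) ∈
      {p : F × ℝ | g p.1 ≤ (p.2 : EReal)} :=
    hg.isClosed_epi.mem_of_tendsto (hlim.prodMk_nhds tendsto_const_nhds) hb
  exact ne_top_of_le_ne_top (EReal.coe_ne_top _) hmem

end Subgradient

/-! ### Convex functions with Lipschitz gradient. -/

section Smooth

variable {E : Type*} [NormedAddCommGroup E] [InnerProductSpace ℝ E] [CompleteSpace E]

theorem hasDerivAt_comp_segment {φ : E → ℝ} (hφ : Differentiable ℝ φ) (u d : E) (t : ℝ) :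
    HasDerivAt (fun t : ℝ => φ (u + t • d)) ⟪gradient φ (u + t • d), d⟫_ℝ t := by
  have hl : HasDerivAt (fun t : ℝ => u + t • d) d t := by
    simpa using ((hasDerivAt_id t).smul_const d).const_add u
  have h1 := (hφ (u + t • d)).hasGradientAt.hasFDerivAt
  exact (h1.comp_hasDerivAt t hl).congr_deriv (by simp)

/-- The descent lemma for functions with Lipschitz gradient. -/
theorem le_add_inner_gradient_add {φ : E → ℝ} (hφ : Differentiable ℝ φ) {L : ℝ≥0}
    (hL : LipschitzWith L (gradient φ)) (u v : E) :
    φ v ≤ φ u + ⟪gradient φ u, v - u⟫_ℝ + L / 2 * ‖v - u‖ ^ 2 := by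
  set d := v - u with hd
  have hder : ∀ t : ℝ, HasDerivAt
      (fun t : ℝ => φ (u + t • d) - (t * ⟪gradient φ u, d⟫_ℝ + L / 2 * ‖d‖ ^ 2 * t ^ 2))
      (⟪gradient φ (u + t • d), d⟫_ℝ - (⟪gradient φ u, d⟫_ℝ + L * ‖d‖ ^ 2 * t)) t := by
    intro t
    refine (hasDerivAt_comp_segment hφ u d t).sub ?_
    have h1 := (hasDerivAt_id t).mul_const ⟪gradient φ u, d⟫_ℝ
    have h2 := (hasDerivAt_pow 2 t).const_mul ((L : ℝ) / 2 * ‖d‖ ^ 2)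
    refine (h1.add h2).congr_deriv ?_
    simp
    ring
  have hanti := antitoneOn_of_hasDerivWithinAt_nonpos (convex_Icc (0 : ℝ) 1)
    (fun t _ => (hder t).continuousAt.continuousWithinAt)
    (fun t _ => (hder t).hasDerivWithinAt) (fun t ht => by
      rw [interior_Icc] at ht
      have h1 : ⟪gradient φ (u + t • d) - gradient φ u, d⟫_ℝ ≤ L * (t * ‖d‖) * ‖d‖ := by
        refine (real_inner_le_norm _ _).trans (mul_le_mul_of_nonneg_right ?_ (norm_nonneg _))
        have h2 := hL.norm_sub_le (u + t • d) u
        rwa [add_sub_cancel_left, norm_smul, Real.norm_of_nonneg ht.1.le] at h2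
      rw [inner_sub_left] at h1
      nlinarith)
  have h := hanti (Set.left_mem_Icc.2 zero_le_one) (Set.right_mem_Icc.2 zero_le_one) zero_le_one
  simp only [one_smul, zero_smul, add_zero] at h
  rw [hd, add_sub_cancel] at h
  rw [hd]
  linarith

theorem add_inner_gradient_le {φ : E → ℝ} (hc : ConvexOn ℝ Set.univ φ)
    (hφ : Differentiable ℝ φ) (u v : E) : φ u + ⟪gradient φ u, v - u⟫_ℝ ≤ φ v := by
  have hs := (hasDerivAt_comp_segment hφ u (v - u) 0).tendsto_slope_zero_right
  simp only [zero_smul, add_zero, zero_add, smul_eq_mul] at hs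
  have : ⟪gradient φ u, v - u⟫_ℝ ≤ φ v - φ u := by
    refine le_of_tendsto hs ?_
    filter_upwards [Ioo_mem_nhdsGT (zero_lt_one' ℝ)] with t ht
    rw [inv_mul_eq_div, div_le_iff₀ ht.1]
    have h1 := hc.2 (Set.mem_univ u) (Set.mem_univ v) (sub_nonneg.2 ht.2.le) ht.1.le (by ring)
    have h2 : (1 - t) • u + t • v = u + t • (v - u) := by module
    rw [h2] at h1
    simp only [smul_eq_mul] at h1
    linarith
  linarith

/-- The three-point form of the cocoercivity of the gradient of a convex function. -/
theorem neg_le_inner_gradient_sub {φ : E → ℝ} (hc : ConvexOn ℝ Set.univ φ)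
    (hφ : Differentiable ℝ φ) {L : ℝ≥0} (hL : LipschitzWith L (gradient φ)) (x x' p p' : E) :
    -(L / 4 * ‖(p - p') - (x - x')‖ ^ 2) ≤
      ⟪gradient φ x - gradient φ x', p - p'⟫_ℝ := by
  -- At each of x + e and x' - e, a convexity lower bound from one base point meets a descent upper
  -- bound from the other. Their sum is ⟨∇φ(x) - ∇φ(x'), x - x' + 2e⟩ ≥ -L‖e‖²; taking e as half the
  -- discrepancy gives L/4.
  set e : E := (1 / 2 : ℝ) • ((p - p') - (x - x')) with he
  have h1 := add_inner_gradient_le hc hφ x' (x + e)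
  have h2 := le_add_inner_gradient_add hφ hL x (x + e)
  have h3 := add_inner_gradient_le hc hφ x (x' - e)
  have h4 := le_add_inner_gradient_add hφ hL x' (x' - e)
  have h5 : p - p' = x - x' + (2 : ℝ) • e := by rw [he]; module
  have h6 : ‖(p - p') - (x - x')‖ ^ 2 = 4 * ‖e‖ ^ 2 := by
    rw [he, norm_smul]; norm_num; ring
  have h7 : x' - e - x' = -e := by abel
  rw [add_sub_cancel_left] at h2
  rw [h7, norm_neg] at h4
  have h8 : x + e - x' = (x - x') + e := by abel
  have h9 : x' - e - x = -((x - x') + e) := by abel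
  rw [h8] at h1
  rw [h9] at h3
  rw [h6, h5]
  simp only [inner_add_right, inner_neg_right, inner_sub_left, inner_smul_right] at *
  linarith

end Smooth

/-! ### One iteration: contraction, and comparison across a change of step sizes. -/

section Step

variable {E F : Type*}
  [NormedAddCommGroup E] [InnerProductSpace ℝ E] [CompleteSpace E]
  [NormedAddCommGroup F] [InnerProductSpace ℝ F] [CompleteSpace F]

/-- The optimality conditions of the two proximal steps of a Tri-PD iteration that takes `(x, y)`
to the intermediate primal point `p` and the dual point `q`. -/
structure IsStep (f : E → EReal) (f₂ : E → ℝ) (g : F → EReal) (A : E →L[ℝ] F) (τ σ : ℝ)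
    (x : E) (y : F) (p : E) (q : F) : Prop where
  primal : IsSubgradient f p (τ⁻¹ • (x - p) - gradient f₂ x - A.adjoint y)
  dual : IsSubgradient (fenchelConj g) q (σ⁻¹ • (y - q) + A p)

theorem norm_adjoint_apply_le (A : E →L[ℝ] F) (v : F) : ‖A.adjoint v‖ ≤ ‖A‖ * ‖v‖ := by
  have h := A.adjoint.le_opNorm v
  rwa [LinearIsometryEquiv.norm_map] at h

/-- The energy estimate behind the contraction property, in terms of differences. -/
theorem energy_estimate (A : E →L[ℝ] F) {τ σ L : ℝ} (hτ : 0 < τ) (hσ : 0 < σ) {dx dp G : E}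
    {dy dq : F} (hp : 0 ≤ ⟪τ⁻¹ • (dx - dp) - G - A.adjoint dy, dp⟫_ℝ)
    (hq : 0 ≤ ⟪σ⁻¹ • (dy - dq) + A dp, dq⟫_ℝ) (hG : -(L / 4 * ‖dp - dx‖ ^ 2) ≤ ⟪G, dp⟫_ℝ) :
    sqNormV τ σ (dp - τ • A.adjoint (dq - dy)) dq ≤
      sqNormV τ σ dx dy - (1 - τ * L / 2) * (‖dp - dx‖ ^ 2 / τ)
        - (1 - σ * τ * ‖A‖ ^ 2) * (‖dq - dy‖ ^ 2 / σ) := by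
  have he : ‖A.adjoint (dq - dy)‖ ^ 2 ≤ ‖A‖ ^ 2 * ‖dq - dy‖ ^ 2 := by
    rw [← mul_pow]
    exact pow_le_pow_left₀ (norm_nonneg _) (norm_adjoint_apply_le A _) 2
  have hpe : ⟪dp, A.adjoint (dq - dy)⟫_ℝ = ⟪A dp, dq⟫_ℝ - ⟪A dp, dy⟫_ℝ := by
    rw [ContinuousLinearMap.adjoint_inner_right, inner_sub_right]
  have hay : ⟪A.adjoint dy, dp⟫_ℝ = ⟪A dp, dy⟫_ℝ := by
    rw [ContinuousLinearMap.adjoint_inner_left, real_inner_comm]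
  rw [inner_sub_left, inner_sub_left, inner_smul_left, hay, inner_sub_left,
    real_inner_self_eq_norm_sq] at hp
  rw [inner_add_left, inner_smul_left, inner_sub_left, real_inner_self_eq_norm_sq] at hq
  simp only [conj_trivial] at hp hq
  -- The cross term created by the corrected primal step is exactly cancelled by the coupling terms
  -- in twice the sum of `hp` and `hq`.
  have e1 : ‖dp - τ • A.adjoint (dq - dy)‖ ^ 2 / τ =
      τ⁻¹ * ‖dp‖ ^ 2 - 2 * (⟪A dp, dq⟫_ℝ - ⟪A dp, dy⟫_ℝ) + τ * ‖A.adjoint (dq - dy)‖ ^ 2 := by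
    rw [norm_sub_sq_real, inner_smul_right, hpe, norm_smul, Real.norm_of_nonneg hτ.le]
    field_simp
  have e2 : ‖dp - dx‖ ^ 2 = ‖dp‖ ^ 2 - 2 * ⟪dx, dp⟫_ℝ + ‖dx‖ ^ 2 := by
    rw [norm_sub_sq_real, real_inner_comm]
  have e3 : ‖dq - dy‖ ^ 2 = ‖dq‖ ^ 2 - 2 * ⟪dy, dq⟫_ℝ + ‖dy‖ ^ 2 := by
    rw [norm_sub_sq_real, real_inner_comm]
  have e4 : (1 - τ * L / 2) * (‖dp - dx‖ ^ 2 / τ) =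
      τ⁻¹ * (‖dp‖ ^ 2 - 2 * ⟪dx, dp⟫_ℝ + ‖dx‖ ^ 2) - L / 2 * ‖dp - dx‖ ^ 2 := by
    rw [← e2]; field_simp
  have e5 : (1 - σ * τ * ‖A‖ ^ 2) * (‖dq - dy‖ ^ 2 / σ) =
      σ⁻¹ * (‖dq‖ ^ 2 - 2 * ⟪dy, dq⟫_ℝ + ‖dy‖ ^ 2) - τ * (‖A‖ ^ 2 * ‖dq - dy‖ ^ 2) := by
    rw [← e3]; field_simp
  rw [sqNormV, sqNormV, e1, e4, e5, div_eq_inv_mul, div_eq_inv_mul, div_eq_inv_mul]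
  have he' := mul_le_mul_of_nonneg_left he hτ.le
  ring_nf at hp hq he' hG ⊢
  linarith

variable {f : E → EReal} {f₂ : E → ℝ} {g : F → EReal} {A : E →L[ℝ] F}

/-- Two iterations with the same step sizes contract distances. -/
theorem IsStep.contraction (hf₂ : ConvexOn ℝ Set.univ f₂) (hd : Differentiable ℝ f₂) {L : ℝ≥0}
    (hL : LipschitzWith L (gradient f₂)) {τ σ : ℝ} (hτ : 0 < τ) (hσ : 0 < σ)
    {x x' p p' : E} {y y' q q' : F} (h : IsStep f f₂ g A τ σ x y p q)
    (h' : IsStep f f₂ g A τ σ x' y' p' q') :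
    sqNormV τ σ ((p - τ • A.adjoint (q - y)) - (p' - τ • A.adjoint (q' - y'))) (q - q') ≤
      sqNormV τ σ (x - x') (y - y')
        - (1 - τ * L / 2) * (‖(p - p') - (x - x')‖ ^ 2 / τ)
        - (1 - σ * τ * ‖A‖ ^ 2) * (‖(q - q') - (y - y')‖ ^ 2 / σ) := by
  have hp := h.primal.inner_nonneg h'.primal
  have hq := h.dual.inner_nonneg h'.dual
  have hG := neg_le_inner_gradient_sub hf₂ hd hL x x' p p'
  have e1 : τ⁻¹ • (x - p) - gradient f₂ x - A.adjoint y -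
      (τ⁻¹ • (x' - p') - gradient f₂ x' - A.adjoint y') =
      τ⁻¹ • ((x - x') - (p - p')) - (gradient f₂ x - gradient f₂ x') - A.adjoint (y - y') := by
    rw [map_sub]; module
  have e2 : σ⁻¹ • (y - q) + A p - (σ⁻¹ • (y' - q') + A p') =
      σ⁻¹ • ((y - y') - (q - q')) + A (p - p') := by
    rw [map_sub]; module
  have e3 : (p - τ • A.adjoint (q - y)) - (p' - τ • A.adjoint (q' - y')) =
      (p - p') - τ • A.adjoint ((q - q') - (y - y')) := by
    simp only [map_sub]; module
  rw [e1] at hp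
  rw [e2] at hq
  rw [e3]
  exact energy_estimate A hτ hσ hp hq hG

theorem IsStep.le_sqNormV (hf₂ : ConvexOn ℝ Set.univ f₂) (hd : Differentiable ℝ f₂) {L : ℝ≥0}
    (hL : LipschitzWith L (gradient f₂)) {τ σ : ℝ} (hτ : 0 < τ) (hσ : 0 < σ)
    (hτL : τ * L ≤ 2) (hστ : σ * τ * ‖A‖ ^ 2 ≤ 1)
    {x x' p p' : E} {y y' q q' : F} (h : IsStep f f₂ g A τ σ x y p q)
    (h' : IsStep f f₂ g A τ σ x' y' p' q') :
    sqNormV τ σ ((p - τ • A.adjoint (q - y)) - (p' - τ • A.adjoint (q' - y'))) (q - q') ≤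
      sqNormV τ σ (x - x') (y - y') := by
  have h1 := h.contraction hf₂ hd hL hτ hσ h'
  have h2 : 0 ≤ (1 - τ * L / 2) * (‖(p - p') - (x - x')‖ ^ 2 / τ) :=
    mul_nonneg (by linarith) (by positivity)
  have h3 : 0 ≤ (1 - σ * τ * ‖A‖ ^ 2) * (‖(q - q') - (y - y')‖ ^ 2 / σ) :=
    mul_nonneg (by linarith) (by positivity)
  linarith

/-- Turns a monotonicity inequality into a bound on a displacement, by Cauchy-Schwarz. -/
theorem norm_le_of_sq_le_inner {H : Type*} [NormedAddCommGroup H] [InnerProductSpace ℝ H]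
    {a c : H} {B : ℝ} (hB : ‖c‖ ≤ B) (h : 0 ≤ ⟪c - a, a⟫_ℝ) : ‖a‖ ≤ B := by
  rw [inner_sub_left, real_inner_self_eq_norm_sq] at h
  have h1 := real_inner_le_norm c a
  by_contra! hcon
  nlinarith [norm_nonneg a, norm_nonneg c]

/-- The factor by which a change of the step sizes can increase the squared residual. -/
def changeFactor (r : ℝ) : ℝ := r * ((2 + 5 * r) * (1 + r ^ 2)) ^ 2 + r * (r * (2 + 5 * r)) ^ 2

/-- Consecutive iterations with step sizes `(τ, σ)` and `(τ₂, σ₂)` of comparable size have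
comparable residuals. -/
theorem IsStep.sqNormV_le_changeFactor {L : ℝ≥0} (hL : LipschitzWith L (gradient f₂))
    {τ σ τ₂ σ₂ r : ℝ} (hτ : 0 < τ) (hσ : 0 < σ) (hτ₂ : 0 < τ₂) (hσ₂ : 0 < σ₂)
    (hτL : τ * L ≤ 2) (hστ : σ * τ * ‖A‖ ^ 2 ≤ 1) (hr : 0 ≤ r)
    (h1 : τ₂ ≤ r * τ) (h2 : τ ≤ r * τ₂) (h3 : σ₂ ≤ r * σ) (h4 : σ ≤ r * σ₂)
    {x x' p p₂ : E} {y q q₂ : F} (h : IsStep f f₂ g A τ σ x y p q)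
    (hx' : x' = p - τ • A.adjoint (q - y)) (h' : IsStep f f₂ g A τ₂ σ₂ x' q p₂ q₂) :
    sqNormV τ₂ σ₂ (p₂ - τ₂ • A.adjoint (q₂ - q) - x') (q₂ - q) ≤
      changeFactor r * sqNormV τ σ (x' - x) (q - y) := by
  set R := sqNormV τ σ (x' - x) (q - y) with hR
  have hR0 : 0 ≤ R := by rw [hR, sqNormV]; positivity
  set ρ := √R with hρ
  have hρ0 : 0 ≤ ρ := Real.sqrt_nonneg _
  have hρ2 : ρ ^ 2 = R := Real.sq_sqrt hR0
  set a := √τ with ha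
  set b := √σ with hb
  have ha0 : 0 < a := Real.sqrt_pos.2 hτ
  have hb0 : 0 < b := Real.sqrt_pos.2 hσ
  have ha2 : a ^ 2 = τ := Real.sq_sqrt hτ.le
  have hb2 : b ^ 2 = σ := Real.sq_sqrt hσ.le
  set N := ‖A‖ with hN
  have hN0 : 0 ≤ N := norm_nonneg _
  -- Primal quantities are measured in units of aρ and dual ones in units of bρ; this inequality
  -- converts between the units when A or its adjoint is applied.
  have haN : a * N * b ≤ 1 := by
    refine (sq_le_one_iff₀ (by positivity)).1 ?_
    rw [mul_pow, mul_pow, ha2, hb2]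
    linarith
  have hdx : ‖x' - x‖ ≤ a * ρ := by
    refine (sq_le_sq₀ (norm_nonneg _) (by positivity)).1 ?_
    rw [mul_pow, ha2, hρ2, ← div_le_iff₀' hτ, hR, sqNormV]
    exact le_add_of_nonneg_right (by positivity)
  have hdy : ‖q - y‖ ≤ b * ρ := by
    refine (sq_le_sq₀ (norm_nonneg _) (by positivity)).1 ?_
    rw [mul_pow, hb2, hρ2, ← div_le_iff₀' hσ, hR, sqNormV]
    exact le_add_of_nonneg_left (by positivity)
  have hAd : τ * ‖A.adjoint (q - y)‖ ≤ a * ρ := by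
    have h5 := (norm_adjoint_apply_le A (q - y)).trans (mul_le_mul_of_nonneg_left hdy hN0)
    have h6 := mul_le_mul_of_nonneg_left h5 hτ.le
    have h7 := mul_le_mul_of_nonneg_right haN (mul_nonneg ha0.le hρ0)
    have h8 : τ * (N * (b * ρ)) = a * N * b * (a * ρ) := by rw [← ha2]; ring
    rw [← hN] at h6
    linarith
  have he : ‖τ • A.adjoint (q - y)‖ ≤ a * ρ := by
    rwa [norm_smul, Real.norm_of_nonneg hτ.le]
  have hxp : ‖x - p‖ ≤ 2 * (a * ρ) := by
    have h5 : x - p = -(x' - x) - τ • A.adjoint (q - y) := by rw [hx']; abel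
    rw [h5]
    refine (norm_sub_le _ _).trans ?_
    rw [norm_neg]; linarith
  have hgr : τ * ‖gradient f₂ x' - gradient f₂ x‖ ≤ 2 * (a * ρ) := by
    have h5 := hL.norm_sub_le x' x
    have h6 := mul_le_mul_of_nonneg_left h5 hτ.le
    have h7 := mul_le_mul_of_nonneg_right hτL (norm_nonneg (x' - x))
    linarith
  -- The 5 collects 2 from x - p, 2 from the gradients and 1 from the adjoint term; r bounds τ₂/τ,
  -- and the extra 1 is the shift from p to x'.
  have hpp : ‖p - p₂‖ ≤ (1 + 5 * r) * (a * ρ) := by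
    have h5 := h.primal.inner_nonneg h'.primal
    have e1 : τ₂ • (τ⁻¹ • (x - p) - gradient f₂ x - A.adjoint y
        - (τ₂⁻¹ • (x' - p₂) - gradient f₂ x' - A.adjoint q)) =
        (τ₂ • (τ⁻¹ • (x - p) + (gradient f₂ x' - gradient f₂ x) + A.adjoint (q - y))
          + τ • A.adjoint (q - y)) - (p - p₂) := by
      have e3 : p - p₂ = (x' - p₂) + τ • A.adjoint (q - y) := by rw [hx']; abel
      rw [e3]
      simp only [smul_sub, smul_add, smul_inv_smul₀ hτ₂.ne', map_sub]
      module
    have h6 := mul_nonneg hτ₂.le h5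
    rw [← real_inner_smul_left, e1] at h6
    refine norm_le_of_sq_le_inner ?_ h6
    have h7 : ‖τ⁻¹ • (x - p) + (gradient f₂ x' - gradient f₂ x) + A.adjoint (q - y)‖ ≤
        τ⁻¹ * (5 * (a * ρ)) := by
      refine (norm_add₃_le).trans ?_
      rw [norm_smul, Real.norm_of_nonneg (inv_pos.2 hτ).le, le_inv_mul_iff₀ hτ, mul_add, mul_add,
        mul_inv_cancel_left₀ hτ.ne']
      linarith
    have h8 : τ₂ * (τ⁻¹ * (5 * (a * ρ))) ≤ r * (5 * (a * ρ)) := by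
      rw [← mul_assoc]
      refine mul_le_mul_of_nonneg_right ?_ (by positivity)
      rwa [mul_inv_le_iff₀ hτ]
    refine (norm_add_le _ _).trans ?_
    rw [norm_smul, Real.norm_of_nonneg hτ₂.le]
    have h9 := mul_le_mul_of_nonneg_left h7 hτ₂.le
    linarith
  have hp₂ : ‖p₂ - x'‖ ≤ (2 + 5 * r) * (a * ρ) := by
    have e1 : p₂ - x' = -(p - p₂) + τ • A.adjoint (q - y) := by rw [hx']; abel
    rw [e1]
    refine (norm_add_le _ _).trans ?_
    rw [norm_neg]; linarith
  -- Here 2 + 5r is 1 from y - q plus 1 + 5r from A(p - p₂), and the factor r bounds σ₂/σ.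
  have hq₂ : ‖q₂ - q‖ ≤ r * (2 + 5 * r) * (b * ρ) := by
    have h5 := h.dual.inner_nonneg h'.dual
    have e1 : σ₂ • (σ⁻¹ • (y - q) + A p - (σ₂⁻¹ • (q - q₂) + A p₂)) =
        σ₂ • (σ⁻¹ • (y - q) + A (p - p₂)) - (q - q₂) := by
      rw [smul_sub, smul_add (σ₂) (σ₂⁻¹ • (q - q₂)), smul_inv_smul₀ hσ₂.ne', map_sub]
      module
    have h6 := mul_nonneg hσ₂.le h5
    rw [← real_inner_smul_left, e1] at h6
    rw [norm_sub_rev]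
    refine norm_le_of_sq_le_inner ?_ h6
    have h7 : σ * (‖A‖ * ((1 + 5 * r) * (a * ρ))) ≤ (1 + 5 * r) * (b * ρ) := by
      have h8 := mul_le_mul_of_nonneg_right haN
        (show 0 ≤ b * ((1 + 5 * r) * ρ) by positivity)
      have h9 : σ * (‖A‖ * ((1 + 5 * r) * (a * ρ))) =
        a * N * b * (b * ((1 + 5 * r) * ρ)) := by rw [← hb2]; ring
      linarith
    have h8 : ‖σ⁻¹ • (y - q) + A (p - p₂)‖ ≤ σ⁻¹ * ((2 + 5 * r) * (b * ρ)) := by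
      refine (norm_add_le _ _).trans ?_
      rw [norm_smul, Real.norm_of_nonneg (inv_pos.2 hσ).le, le_inv_mul_iff₀ hσ, mul_add,
        mul_inv_cancel_left₀ hσ.ne', norm_sub_rev y q]
      have h9 := (A.le_opNorm (p - p₂)).trans (mul_le_mul_of_nonneg_left hpp (norm_nonneg A))
      have h10 := mul_le_mul_of_nonneg_left h9 hσ.le
      linarith
    rw [norm_smul, Real.norm_of_nonneg hσ₂.le]
    refine (mul_le_mul_of_nonneg_left h8 hσ₂.le).trans ?_
    rw [← mul_assoc, mul_assoc r]
    refine mul_le_mul_of_nonneg_right ?_ (by positivity)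
    rwa [mul_inv_le_iff₀ hσ]
  have hx₂ : ‖p₂ - τ₂ • A.adjoint (q₂ - q) - x'‖ ≤ (2 + 5 * r) * (1 + r ^ 2) * (a * ρ) := by
    have e1 : p₂ - τ₂ • A.adjoint (q₂ - q) - x' = (p₂ - x') - τ₂ • A.adjoint (q₂ - q) := by abel
    rw [e1]
    refine (norm_sub_le _ _).trans ?_
    rw [norm_smul, Real.norm_of_nonneg hτ₂.le]
    have h5 := (norm_adjoint_apply_le A (q₂ - q)).trans (mul_le_mul_of_nonneg_left hq₂ hN0)
    have h6 := mul_le_mul h1 h5 (norm_nonneg _) (by positivity)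
    have h7 := mul_le_mul_of_nonneg_right haN
      (show 0 ≤ a * (r ^ 2 * (2 + 5 * r) * ρ) by positivity)
    have h8 : r * τ * (N * (r * (2 + 5 * r) * (b * ρ))) =
      a * N * b * (a * (r ^ 2 * (2 + 5 * r) * ρ)) := by rw [← ha2]; ring
    linarith
  have f1 : ‖p₂ - τ₂ • A.adjoint (q₂ - q) - x'‖ ^ 2 / τ₂ ≤
      r * ((2 + 5 * r) * (1 + r ^ 2)) ^ 2 * R := by
    rw [div_le_iff₀ hτ₂]
    refine (pow_le_pow_left₀ (norm_nonneg _) hx₂ 2).trans ?_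
    rw [mul_pow, mul_pow a, ha2, hρ2]
    have := mul_le_mul_of_nonneg_left h2
      (show 0 ≤ ((2 + 5 * r) * (1 + r ^ 2)) ^ 2 * R by positivity)
    linarith
  have f2 : ‖q₂ - q‖ ^ 2 / σ₂ ≤ r * (r * (2 + 5 * r)) ^ 2 * R := by
    rw [div_le_iff₀ hσ₂]
    refine (pow_le_pow_left₀ (norm_nonneg _) hq₂ 2).trans ?_
    rw [mul_pow, mul_pow b, hb2, hρ2]
    have := mul_le_mul_of_nonneg_left h4
      (show 0 ≤ (r * (2 + 5 * r)) ^ 2 * R by positivity)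
    linarith
  rw [sqNormV, changeFactor]
  linarith

end Step

/-! ### Counting the changes and comparing the norms. -/

/-- The number of changes of the step sizes before iteration `k`, read off from the indices `s k`
at which the current step sizes were adopted. -/
def numChanges (s : ℕ → ℕ) : ℕ → ℕ
  | 0 => 0
  | k + 1 => numChanges s k + if s (k + 1) = s k then 0 else 1

theorem monotone_numChanges (s : ℕ → ℕ) : Monotone (numChanges s) :=
  monotone_nat_of_le_succ fun _ => Nat.le_add_right _ _

section SqNormV

variable {E F : Type*} [NormedAddCommGroup E] [NormedAddCommGroup F]

theorem sqNormV_nonneg {τ σ : ℝ} (hτ : 0 < τ) (hσ : 0 < σ) (u : E) (v : F) :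
    0 ≤ sqNormV τ σ u v := by
  rw [sqNormV]; positivity

theorem sqNormV_le_mul {r τ σ τ' σ' : ℝ} (hτ : 0 < τ) (hσ : 0 < σ) (hτ' : 0 < τ') (hσ' : 0 < σ')
    (h1 : τ ≤ r * τ') (h2 : σ ≤ r * σ') (u : E) (v : F) :
    sqNormV τ' σ' u v ≤ r * sqNormV τ σ u v := by
  have e1 : ‖u‖ ^ 2 / τ' ≤ r * (‖u‖ ^ 2 / τ) := by
    rw [div_le_iff₀ hτ', ← mul_div_assoc, div_mul_eq_mul_div, le_div_iff₀ hτ]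
    nlinarith [sq_nonneg ‖u‖]
  have e2 : ‖v‖ ^ 2 / σ' ≤ r * (‖v‖ ^ 2 / σ) := by
    rw [div_le_iff₀ hσ', ← mul_div_assoc, div_mul_eq_mul_div, le_div_iff₀ hσ]
    nlinarith [sq_nonneg ‖v‖]
  rw [sqNormV, sqNormV]
  linarith

end SqNormV

/-! ### Growth and decay along an adaptive run. -/

section Run

variable {E F : Type*}
  [NormedAddCommGroup E] [InnerProductSpace ℝ E] [CompleteSpace E]
  [NormedAddCommGroup F] [InnerProductSpace ℝ F] [CompleteSpace F]

/-- An adaptive run together with the standing assumptions on the problem and the step sizes. -/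
structure IsAdmissibleRun (f : E → EReal) (f₂ : E → ℝ) (g : F → EReal) (A : E →L[ℝ] F)
    (L : ℝ≥0) (r δ : ℝ) (x xbar : ℕ → E) (y : ℕ → F) (τ σ : ℕ → ℝ) (s : ℕ → ℕ) : Prop where
  proper_left : IsProperConvexLsc f
  proper_right : IsProperConvexLsc g
  conj_dom : (effDom (fenchelConj g)).Nonempty
  convex : ConvexOn ℝ Set.univ f₂
  diff : Differentiable ℝ f₂
  lip : LipschitzWith L (gradient f₂)
  one_lt : 1 < r
  delta_pos : 0 < δ
  delta_mul_lt : δ * r < 1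
  run : IsAdaptiveRun f f₂ g A r δ x xbar y τ σ s
  norm_lt : σ 0 * τ 0 * ‖A‖ ^ 2 < 1
  tau_lt : ∀ k, τ k * L < 2

variable {f : E → EReal} {f₂ : E → ℝ} {g : F → EReal} {A : E →L[ℝ] F} {L : ℝ≥0} {r δ : ℝ}
  {x xbar : ℕ → E} {y : ℕ → F} {τ σ : ℕ → ℝ} {s : ℕ → ℕ}

namespace IsAdmissibleRun

variable (H : IsAdmissibleRun f f₂ g A L r δ x xbar y τ σ s)

include H

theorem r_pos : 0 < r := zero_lt_one.trans H.one_lt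

/-- Since a change sets s to k + 1 > s k, it always alters s, so `numChanges` misses none. -/
theorem s_le (k : ℕ) : s k ≤ k := by
  induction k with
  | zero => exact H.run.s_zero.le
  | succ k ih =>
    rcases H.run.update k with ⟨-, -, h⟩ | ⟨-, h, -⟩
    · omega
    · omega

theorem update (k : ℕ) :
    (τ (k + 1) = τ k ∧ σ (k + 1) = σ k ∧ s (k + 1) = s k ∧
      numChanges s (k + 1) = numChanges s k) ∨
    ((s k ≠ 0 → sqResidual x y τ σ k ≤ δ * sqResidual x y τ σ (s k - 1)) ∧
      s (k + 1) = k + 1 ∧ numChanges s (k + 1) = numChanges s k + 1 ∧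
      ((τ (k + 1) = τ k * r ∧ σ (k + 1) = σ k * r⁻¹) ∨
       (τ (k + 1) = τ k * r⁻¹ ∧ σ (k + 1) = σ k * r))) := by
  rcases H.run.update k with ⟨h1, h2, h3⟩ | ⟨h1, h2, h3⟩
  · exact Or.inl ⟨h1, h2, h3, by simp [numChanges, h3]⟩
  · refine Or.inr ⟨h1, h2, ?_, h3⟩
    have := H.s_le k
    rw [numChanges, if_neg (by omega)]

theorem tau_pos_sigma_pos (k : ℕ) : 0 < τ k ∧ 0 < σ k := by
  have hr := H.r_pos
  induction k with
  | zero => exact ⟨H.run.tau_pos, H.run.sigma_pos⟩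
  | succ k ih =>
    obtain ⟨h1, h2⟩ := ih
    rcases H.update k with ⟨e1, e2, -⟩ | ⟨-, -, -, ⟨e1, e2⟩ | ⟨e1, e2⟩⟩ <;> rw [e1, e2] <;>
      constructor <;> positivity

theorem tau_pos (k : ℕ) : 0 < τ k := (H.tau_pos_sigma_pos k).1

theorem sigma_pos (k : ℕ) : 0 < σ k := (H.tau_pos_sigma_pos k).2

/-- The factors r and r⁻¹ cancel, so the norm condition on the initial step sizes persists. -/
theorem sigma_mul_tau (k : ℕ) : σ k * τ k = σ 0 * τ 0 := by
  have hr := H.r_pos.ne'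
  induction k with
  | zero => rfl
  | succ k ih =>
    rw [← ih]
    rcases H.update k with ⟨e1, e2, -⟩ | ⟨-, -, -, ⟨e1, e2⟩ | ⟨e1, e2⟩⟩ <;> rw [e1, e2] <;>
      field_simp

theorem norm_lt_one (k : ℕ) : σ k * τ k * ‖A‖ ^ 2 < 1 := by
  rw [H.sigma_mul_tau k]
  exact H.norm_lt

theorem le_mul_self_of_pos {t : ℝ} (ht : 0 < t) : t ≤ r * t ∧ t * r⁻¹ ≤ r * t ∧
    t ≤ r * (t * r) ∧ t ≤ r * (t * r⁻¹) ∧ t * r ≤ r * t := by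
  have hr := H.one_lt
  have hr0 := H.r_pos
  have h1 : t ≤ r * t := le_mul_of_one_le_left ht.le hr.le
  have h2 : t * r⁻¹ ≤ t := mul_le_of_le_one_right ht.le (inv_le_one_of_one_le₀ hr.le)
  have h3 : r * t ≤ r * (r * t) := le_mul_of_one_le_left (by positivity) hr.le
  refine ⟨h1, h2.trans h1, ?_, ?_, by rw [mul_comm]⟩
  · rw [mul_comm t r]; exact h1.trans h3
  · rw [mul_comm t, mul_inv_cancel_left₀ hr0.ne']

/-- Consecutive step sizes are comparable. -/
theorem comparable (k : ℕ) : τ (k + 1) ≤ r * τ k ∧ τ k ≤ r * τ (k + 1) ∧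
    σ (k + 1) ≤ r * σ k ∧ σ k ≤ r * σ (k + 1) := by
  obtain ⟨a1, a2, a3, a4, a5⟩ := H.le_mul_self_of_pos (H.tau_pos k)
  obtain ⟨b1, b2, b3, b4, b5⟩ := H.le_mul_self_of_pos (H.sigma_pos k)
  rcases H.update k with ⟨e1, e2, -⟩ | ⟨-, -, -, ⟨e1, e2⟩ | ⟨e1, e2⟩⟩ <;> rw [e1, e2]
  · exact ⟨a1, a1, b1, b1⟩
  · exact ⟨a5, a3, b2, b4⟩
  · exact ⟨a2, a4, b5, b3⟩

theorem sigma_zero_le (k : ℕ) : σ 0 ≤ r ^ numChanges s k * σ k := by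
  have hr := H.r_pos
  induction k with
  | zero => simp [numChanges]
  | succ k ih =>
    rcases H.update k with ⟨-, e2, -, e3⟩ | ⟨-, -, e3, -⟩
    · rwa [e2, e3]
    · have := mul_le_mul_of_nonneg_left (H.comparable k).2.2.2 (pow_pos hr (numChanges s k)).le
      rw [e3, pow_succ, mul_assoc]
      exact ih.trans this

theorem isStep (k : ℕ) : IsStep f f₂ g A (τ k) (σ k) (x k) (y k) (xbar (k + 1)) (y (k + 1)) := by
  constructor
  · have h := isSubgradient_of_isProx H.proper_left.ne_bot H.proper_left.convex_epi
      H.proper_left.nonempty_dom (H.run.xbar_step k)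
    convert h using 1
    simp only [smul_sub, inv_smul_smul₀ (H.tau_pos k).ne']
    abel
  · have h := isSubgradient_of_isProx
      (fenchelConj_ne_bot H.proper_right.ne_bot H.proper_right.nonempty_dom)
      (convex_epi_fenchelConj H.proper_right.ne_bot) H.conj_dom (H.run.y_step k)
    convert h using 1
    simp only [smul_sub, smul_add, inv_smul_smul₀ (H.sigma_pos k).ne']
    abel

theorem sqResidual_nonneg (k : ℕ) : 0 ≤ sqResidual x y τ σ k :=
  sqNormV_nonneg (H.tau_pos k) (H.sigma_pos k) _ _

/-- Iterations k and k + 1 apply the same nonexpansive map to z_k and z_{k+1}. -/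
theorem sqResidual_succ_le (k : ℕ) (hτ : τ (k + 1) = τ k) (hσ : σ (k + 1) = σ k) :
    sqResidual x y τ σ (k + 1) ≤ sqResidual x y τ σ k := by
  have h' := H.isStep (k + 1)
  rw [hτ, hσ] at h'
  have h := h'.le_sqNormV H.convex H.diff H.lip (H.tau_pos k) (H.sigma_pos k) (H.tau_lt k).le
    (H.norm_lt_one k).le (H.isStep k)
  have e := H.run.x_step (k + 1)
  rw [hτ] at e
  rw [← H.run.x_step k, ← e] at h
  rwa [sqResidual, sqResidual, hτ, hσ]

theorem sqResidual_succ_le_changeFactor (k : ℕ) :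
    sqResidual x y τ σ (k + 1) ≤ changeFactor r * sqResidual x y τ σ k := by
  obtain ⟨h1, h2, h3, h4⟩ := H.comparable k
  have h := (H.isStep k).sqNormV_le_changeFactor H.lip (H.tau_pos k) (H.sigma_pos k)
    (H.tau_pos (k + 1)) (H.sigma_pos (k + 1)) (H.tau_lt k).le (H.norm_lt_one k).le H.r_pos.le
    h1 h2 h3 h4 (H.run.x_step k) (H.isStep (k + 1))
  rwa [← H.run.x_step (k + 1)] at h

/-- The squared residual decreases geometrically in the number of changes. -/
theorem sqResidual_le (k : ℕ) : sqResidual x y τ σ k ≤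
    max 1 (changeFactor r / δ) * (δ ^ numChanges s k * sqResidual x y τ σ 0) := by
  set R := sqResidual x y τ σ with hR
  set K := max 1 (changeFactor r / δ) with hK
  have hδ := H.delta_pos
  have hK0 : changeFactor r ≤ K * δ := by
    rw [← div_le_iff₀ hδ]; exact le_max_right _ _
  have hR0 : ∀ k, 0 ≤ R k := H.sqResidual_nonneg
  -- The induction carries the residual just before the last change; only this one is compared in
  -- the drop test, so `changeFactor` enters once and never compounds. The δ on the left of the
  -- second clause accounts for the first change, which requires no drop.
  suffices h : (s k = 0 → numChanges s k = 0 ∧ R k ≤ R 0) ∧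
      (s k ≠ 0 → δ * R (s k - 1) ≤ δ ^ numChanges s k * R 0) ∧
      R k ≤ K * (δ ^ numChanges s k * R 0) from h.2.2
  induction k with
  | zero =>
    refine ⟨fun _ => ⟨rfl, le_rfl⟩, fun h => absurd H.run.s_zero h, ?_⟩
    simpa [numChanges] using le_mul_of_one_le_left (hR0 0) (le_max_left _ _)
  | succ k ih =>
    obtain ⟨i1, i2, i3⟩ := ih
    rcases H.update k with ⟨e1, e2, e3, e4⟩ | ⟨h1, e3, e4, -⟩
    · have hle : R (k + 1) ≤ R k := H.sqResidual_succ_le k e1 e2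
      rw [e3, e4]
      exact ⟨fun h => ⟨(i1 h).1, hle.trans (i1 h).2⟩, i2, hle.trans i3⟩
    · have hle : R (k + 1) ≤ changeFactor r * R k := H.sqResidual_succ_le_changeFactor k
      have hbound : R k ≤ δ ^ numChanges s k * R 0 := by
        by_cases hs : s k = 0
        · obtain ⟨j1, j2⟩ := i1 hs
          simpa [j1] using j2
        · exact (h1 hs).trans (i2 hs)
      rw [e3, e4]
      refine ⟨fun h => by omega, fun _ => ?_, ?_⟩
      · rw [Nat.add_sub_cancel, pow_succ', mul_assoc]
        exact mul_le_mul_of_nonneg_left hbound hδ.le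
      · have h2 := mul_le_mul_of_nonneg_right hK0 (hR0 k)
        have h3 := mul_le_mul_of_nonneg_left hbound
          (show 0 ≤ K * δ from mul_nonneg (zero_le_one.trans (le_max_left _ _)) hδ.le)
        rw [pow_succ']
        linarith

section Saddle

variable {xs : E} {ys : F}

theorem contraction_saddle (hs : ∀ τ σ : ℝ, IsStep f f₂ g A τ σ xs ys xs ys) (k : ℕ) :
    sqNormV (τ k) (σ k) (x (k + 1) - xs) (y (k + 1) - ys) ≤
      sqNormV (τ k) (σ k) (x k - xs) (y k - ys)
        - (1 - τ k * L / 2) * (‖xbar (k + 1) - x k‖ ^ 2 / τ k)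
        - (1 - σ k * τ k * ‖A‖ ^ 2) * (‖y (k + 1) - y k‖ ^ 2 / σ k) := by
  have h := (H.isStep k).contraction H.convex H.diff H.lip (H.tau_pos k) (H.sigma_pos k)
    (hs (τ k) (σ k))
  rw [← H.run.x_step k] at h
  simpa using h

/-- The squared distance to a saddle point grows at most by the factor `r` per change. -/
theorem sqNormV_sub_saddle_le (hs : ∀ τ σ : ℝ, IsStep f f₂ g A τ σ xs ys xs ys) (k : ℕ) :
    sqNormV (τ k) (σ k) (x k - xs) (y k - ys) ≤
      r ^ numChanges s k * sqNormV (τ 0) (σ 0) (x 0 - xs) (y 0 - ys) := by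
  induction k with
  | zero => simp [numChanges]
  | succ k ih =>
    have h1 := H.contraction_saddle hs k
    have h2 : 0 ≤ (1 - τ k * L / 2) * (‖xbar (k + 1) - x k‖ ^ 2 / τ k) :=
      mul_nonneg (by linarith [H.tau_lt k]) (div_nonneg (sq_nonneg _) (H.tau_pos k).le)
    have h3 : 0 ≤ (1 - σ k * τ k * ‖A‖ ^ 2) * (‖y (k + 1) - y k‖ ^ 2 / σ k) :=
      mul_nonneg (by linarith [H.norm_lt_one k]) (div_nonneg (sq_nonneg _) (H.sigma_pos k).le)
    have h4 : sqNormV (τ k) (σ k) (x (k + 1) - xs) (y (k + 1) - ys) ≤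
      r ^ numChanges s k * sqNormV (τ 0) (σ 0) (x 0 - xs) (y 0 - ys) := by linarith
    rcases H.update k with ⟨e1, e2, -, e4⟩ | ⟨-, -, e4, -⟩
    · rwa [e1, e2, e4]
    · obtain ⟨-, c2, -, c4⟩ := H.comparable k
      refine (sqNormV_le_mul (H.tau_pos k) (H.sigma_pos k) (H.tau_pos _) (H.sigma_pos _)
        c2 c4 _ _).trans ?_
      rw [e4, pow_succ', mul_assoc]
      exact mul_le_mul_of_nonneg_left h4 H.r_pos.le

/-- The correction separating x_{k+1} from x̄_{k+1} is dominated by the dual part of the residual,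
so either primal displacement can replace the other up to constants. -/
theorem norm_smul_adjoint_sq_div_le (k : ℕ) :
    ‖τ k • A.adjoint (y (k + 1) - y k)‖ ^ 2 / τ k ≤ ‖y (k + 1) - y k‖ ^ 2 / σ k := by
  have hτ := H.tau_pos k
  have hσ := H.sigma_pos k
  have h1 : ‖A.adjoint (y (k + 1) - y k)‖ ^ 2 ≤ ‖A‖ ^ 2 * ‖y (k + 1) - y k‖ ^ 2 := by
    rw [← mul_pow]
    exact pow_le_pow_left₀ (norm_nonneg _) (norm_adjoint_apply_le A _) 2
  have h2 := mul_le_mul_of_nonneg_right (H.norm_lt_one k).le (sq_nonneg ‖y (k + 1) - y k‖)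
  have h3 := mul_le_mul_of_nonneg_left h1 (mul_pos hσ hτ).le
  have e : ‖τ k • A.adjoint (y (k + 1) - y k)‖ ^ 2 / τ k =
      τ k * ‖A.adjoint (y (k + 1) - y k)‖ ^ 2 := by
    rw [norm_smul, Real.norm_of_nonneg hτ.le]; field_simp
  rw [e, le_div_iff₀ hσ]
  linarith

theorem norm_xbar_sub_sq_div_le (k : ℕ) :
    ‖xbar (k + 1) - x k‖ ^ 2 / τ k ≤ 2 * sqResidual x y τ σ k := by
  have h1 := H.norm_smul_adjoint_sq_div_le k
  have e : xbar (k + 1) - x k = (x (k + 1) - x k) + τ k • A.adjoint (y (k + 1) - y k) := by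
    rw [H.run.x_step k]; abel
  have h2 : ‖xbar (k + 1) - x k‖ ^ 2 ≤
      2 * (‖x (k + 1) - x k‖ ^ 2 + ‖τ k • A.adjoint (y (k + 1) - y k)‖ ^ 2) := by
    rw [e]
    exact (pow_le_pow_left₀ (norm_nonneg _) (norm_add_le _ _) 2).trans (add_sq_le)
  have h3 := div_le_div_of_nonneg_right h2 (H.tau_pos k).le
  rw [mul_div_assoc, add_div] at h3
  rw [sqResidual, sqNormV]
  linarith

theorem sqResidual_le_add (k : ℕ) : sqResidual x y τ σ k ≤
    2 * (‖xbar (k + 1) - x k‖ ^ 2 / τ k) + 3 * (‖y (k + 1) - y k‖ ^ 2 / σ k) := by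
  have h1 := H.norm_smul_adjoint_sq_div_le k
  have e : x (k + 1) - x k = (xbar (k + 1) - x k) - τ k • A.adjoint (y (k + 1) - y k) := by
    rw [H.run.x_step k]; abel
  have h2 : ‖x (k + 1) - x k‖ ^ 2 ≤
      2 * (‖xbar (k + 1) - x k‖ ^ 2 + ‖τ k • A.adjoint (y (k + 1) - y k)‖ ^ 2) := by
    rw [e]
    exact (pow_le_pow_left₀ (norm_nonneg _) (norm_sub_le _ _) 2).trans (add_sq_le)
  have h3 := div_le_div_of_nonneg_right h2 (H.tau_pos k).le
  rw [mul_div_assoc, add_div] at h3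
  rw [sqResidual, sqNormV]
  linarith

/-- If the step sizes are eventually constant, the residuals converge to zero. -/
theorem tendsto_sqResidual_of_const (hs : ∀ τ σ : ℝ, IsStep f f₂ g A τ σ xs ys xs ys) (N : ℕ)
    (hτ : ∀ k, τ (N + k) = τ N) (hσ : ∀ k, σ (N + k) = σ N) :
    Tendsto (sqResidual x y τ σ) atTop (𝓝 0) := by
  set c := min (1 - τ N * L / 2) (1 - σ N * τ N * ‖A‖ ^ 2) with hc
  have hc0 : 0 < c := lt_min (by linarith [H.tau_lt N]) (by linarith [H.norm_lt_one N])
  set D : ℕ → ℝ := fun k => sqNormV (τ N) (σ N) (x (N + k) - xs) (y (N + k) - ys) with hD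
  -- The residual is at most 2P + 3Q ≤ 3(P + Q), and c(P + Q) is lost by D in each iteration.
  have hdec : ∀ k, c / 3 * sqResidual x y τ σ (N + k) ≤ D k - D (k + 1) := by
    intro k
    have h1 := H.contraction_saddle hs (N + k)
    have h2 := H.sqResidual_le_add (N + k)
    rw [hτ, hσ] at h1 h2
    set P := ‖xbar (N + k + 1) - x (N + k)‖ ^ 2 / τ N
    set Q := ‖y (N + k + 1) - y (N + k)‖ ^ 2 / σ N
    have hP : 0 ≤ P := div_nonneg (sq_nonneg _) (H.tau_pos N).le
    have hQ : 0 ≤ Q := div_nonneg (sq_nonneg _) (H.sigma_pos N).le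
    have h3 := mul_le_mul_of_nonneg_right (min_le_left _ _ : c ≤ 1 - τ N * L / 2) hP
    have h4 := mul_le_mul_of_nonneg_right (min_le_right _ _ : c ≤ 1 - σ N * τ N * ‖A‖ ^ 2) hQ
    have h5 := mul_le_mul_of_nonneg_left h2 (show 0 ≤ c / 3 by positivity)
    have h6 := mul_nonneg hc0.le hP
    simp only [hD, ← add_assoc]
    linarith
  have hR0 : ∀ k, 0 ≤ c / 3 * sqResidual x y τ σ (N + k) := fun k =>
    mul_nonneg (by positivity) (H.sqResidual_nonneg _)
  have hanti : Antitone D := antitone_nat_of_succ_le fun k => by linarith [hdec k, hR0 k]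
  have hlim := tendsto_atTop_ciInf hanti
    ⟨0, by rintro _ ⟨k, rfl⟩; exact sqNormV_nonneg (H.tau_pos N) (H.sigma_pos N) _ _⟩
  have hdiff := hlim.sub (hlim.comp (tendsto_add_atTop_nat 1))
  rw [sub_self] at hdiff
  have h1 := (squeeze_zero hR0 hdec hdiff).const_mul (c / 3)⁻¹
  simp only [inv_mul_cancel_left₀ (show c / 3 ≠ 0 by positivity), mul_zero] at h1
  rw [← tendsto_add_atTop_iff_nat N]
  simpa only [add_comm] using h1

/-- The squared residuals vanish faster than the step sizes can degenerate. -/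
theorem tendsto_sqResidual_mul (hs : ∀ τ σ : ℝ, IsStep f f₂ g A τ σ xs ys xs ys) :
    Tendsto (fun k => sqResidual x y τ σ k * r ^ numChanges s k) atTop (𝓝 0) := by
  have hr := H.r_pos
  -- With unboundedly many changes the product decays like (δr)^N; otherwise the count attains its
  -- maximum and the step sizes are constant from then on.
  by_cases hinf : ∀ N, ∃ k, N ≤ numChanges s k
  · have hJ : Tendsto (numChanges s) atTop atTop :=
      tendsto_atTop_atTop_of_monotone (monotone_numChanges s) hinf
    have hgeo := (tendsto_pow_atTop_nhds_zero_of_lt_one (mul_pos H.delta_pos hr).le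
      H.delta_mul_lt).comp hJ
    have hlim := hgeo.const_mul (max 1 (changeFactor r / δ) * sqResidual x y τ σ 0)
    rw [mul_zero] at hlim
    refine squeeze_zero (fun k => mul_nonneg (H.sqResidual_nonneg k) (pow_pos hr _).le)
      (fun k => ?_) hlim
    have h := mul_le_mul_of_nonneg_right (H.sqResidual_le k) (pow_pos hr (numChanges s k)).le
    rw [Function.comp_apply, mul_pow]
    linarith
  · push Not at hinf
    obtain ⟨B, hB⟩ := hinf
    obtain ⟨N, hN⟩ : ∃ N, ∀ k, numChanges s k ≤ numChanges s N := by
      have hbdd : BddAbove (Set.range (numChanges s)) :=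
        ⟨B, by rintro _ ⟨k, rfl⟩; exact (hB k).le⟩
      obtain ⟨N, hN⟩ := Nat.sSup_mem (Set.range_nonempty _) hbdd
      exact ⟨N, fun k => hN ▸ le_csSup hbdd ⟨k, rfl⟩⟩
    have hconst : ∀ k, numChanges s (N + k) = numChanges s N := fun k =>
      le_antisymm (hN _) (monotone_numChanges s (Nat.le_add_right _ _))
    have hsteps : ∀ k, τ (N + k) = τ N ∧ σ (N + k) = σ N := by
      intro k
      induction k with
      | zero => exact ⟨rfl, rfl⟩
      | succ k ih =>
        rcases H.update (N + k) with ⟨e1, e2, -⟩ | ⟨-, -, e4, -⟩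
        · exact ⟨e1.trans ih.1, e2.trans ih.2⟩
        · have h1 := hconst k
          have h2 := hN (N + k + 1)
          omega
    have h := (H.tendsto_sqResidual_of_const hs N (fun k => (hsteps k).1)
      (fun k => (hsteps k).2)).mul_const (r ^ numChanges s N)
    rw [zero_mul] at h
    refine h.congr' ?_
    filter_upwards [eventually_ge_atTop N] with k hk
    obtain ⟨j, rfl⟩ := Nat.exists_eq_add_of_le hk
    rw [hconst]

end Saddle

end IsAdmissibleRun

end Run

/-! ### Real-valued forms of the Lagrangian, the objective and the saddle-point conditions. -/

section Values

variable {E F : Type*} [NormedAddCommGroup E] [InnerProductSpace ℝ E]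
  [NormedAddCommGroup F] [InnerProductSpace ℝ F]
  {f : E → EReal} {f₂ : E → ℝ} {g : F → EReal} {A : E →L[ℝ] F} {xs : E} {ys : F}

theorem lagrangian_eq_coe (hf : IsProperConvexLsc f) (hg : IsProperConvexLsc g) {x : E} {y : F}
    (hx : f x ≠ ⊤) (hy : fenchelConj g y ≠ ⊤) : lagrangian f f₂ g A x y =
      (((f x).toReal + f₂ x + ⟪A x, y⟫_ℝ - (fenchelConj g y).toReal : ℝ) : EReal) := by
  rw [lagrangian, EReal.coe_sub, EReal.coe_add, EReal.coe_add, EReal.coe_toReal hx (hf.ne_bot x),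
    EReal.coe_toReal hy (fenchelConj_ne_bot hg.ne_bot hg.nonempty_dom y)]

theorem IsSaddlePoint.isSubgradient_conj (hf : IsProperConvexLsc f) (hg : IsProperConvexLsc g)
    (h : IsSaddlePoint f f₂ g A xs ys) : IsSubgradient (fenchelConj g) ys (A xs) := by
  obtain ⟨hx, hy, h1, -⟩ := h
  refine ⟨hy, fun y hy' => ?_⟩
  have h2 := h1 y
  rw [lagrangian_eq_coe hf hg hx hy', lagrangian_eq_coe hf hg hx hy, EReal.coe_le_coe_iff] at h2
  rw [inner_sub_right]
  linarith

theorem IsSaddlePoint.primal_le (hf : IsProperConvexLsc f) (hg : IsProperConvexLsc g)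
    (h : IsSaddlePoint f f₂ g A xs ys) {u : E} (hu : f u ≠ ⊤) :
    (f xs).toReal + f₂ xs + ⟪A xs, ys⟫_ℝ ≤ (f u).toReal + f₂ u + ⟪A u, ys⟫_ℝ := by
  obtain ⟨hx, hy, -, h1⟩ := h
  have h2 := h1 u
  rw [lagrangian_eq_coe hf hg hx hy, lagrangian_eq_coe hf hg hu hy, EReal.coe_le_coe_iff] at h2
  linarith

theorem objective_sub_objective (hf : IsProperConvexLsc f) (hg : IsProperConvexLsc g) {p p' : E}
    {w w' : F} (hp : f p ≠ ⊤) (hw : g w ≠ ⊤) (hp' : f p' ≠ ⊤) (hw' : g w' ≠ ⊤) :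
    objective f f₂ g p w - objective f f₂ g p' w' =
      (((f p).toReal + f₂ p + (g w).toReal
        - ((f p').toReal + f₂ p' + (g w').toReal) : ℝ) : EReal) := by
  simp only [objective, EReal.coe_sub, EReal.coe_add, EReal.coe_toReal hp (hf.ne_bot p),
    EReal.coe_toReal hp' (hf.ne_bot p'), EReal.coe_toReal hw (hg.ne_bot w),
    EReal.coe_toReal hw' (hg.ne_bot w')]

theorem inner_div_le_sqrt {a b : E}
    {γ P Q : ℝ} (hγ : 0 < γ) (hP : ‖a‖ ^ 2 / γ ≤ P) (hQ : ‖b‖ ^ 2 / γ ≤ Q) :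
    ⟪a, b⟫_ℝ / γ ≤ √(P * Q) := by
  have h1 : ⟪a, b⟫_ℝ / γ ≤ ‖a‖ * ‖b‖ / γ :=
    div_le_div_of_nonneg_right (real_inner_le_norm a b) hγ.le
  refine h1.trans (Real.le_sqrt_of_sq_le ?_)
  have h2 : (‖a‖ * ‖b‖ / γ) ^ 2 = ‖a‖ ^ 2 / γ * (‖b‖ ^ 2 / γ) := by
    field_simp
  rw [h2]
  exact mul_le_mul hP hQ (by positivity) ((by positivity : 0 ≤ ‖a‖ ^ 2 / γ).trans hP)

end Values

section Saddle

variable {E F : Type*}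
  [NormedAddCommGroup E] [InnerProductSpace ℝ E] [CompleteSpace E]
  [NormedAddCommGroup F] [InnerProductSpace ℝ F] [CompleteSpace F]
  {f : E → EReal} {f₂ : E → ℝ} {g : F → EReal} {A : E →L[ℝ] F} {xs : E} {ys : F}

/-- Saddle points are fixed points of the iteration. -/
theorem IsSaddlePoint.isStep (hf : IsProperConvexLsc f) (hg : IsProperConvexLsc g)
    (hd : Differentiable ℝ f₂) (h : IsSaddlePoint f f₂ g A xs ys) (τ σ : ℝ) :
    IsStep f f₂ g A τ σ xs ys xs ys := by
  constructor
  · have hgrad : HasGradientAt (fun u => f₂ u + ⟪A u, ys⟫_ℝ)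
        (gradient f₂ xs + A.adjoint ys) xs := by
      rw [hasGradientAt_iff_hasFDerivAt]
      have h1 := (hd xs).hasGradientAt.hasFDerivAt
      have h2 : HasFDerivAt (fun u => ⟪A u, ys⟫_ℝ)
          ((InnerProductSpace.toDual ℝ E) (A.adjoint ys)) xs := by
        have h3 := ((InnerProductSpace.toDual ℝ E) (A.adjoint ys)).hasFDerivAt (x := xs)
        refine h3.congr_of_eventuallyEq (Eventually.of_forall fun u => ?_)
        simp only [InnerProductSpace.toDual_apply_apply]
        rw [ContinuousLinearMap.adjoint_inner_left, real_inner_comm]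
      rw [map_add]
      exact h1.add h2
    have h4 := isSubgradient_of_min hf.ne_bot hf.convex_epi h.1 hgrad fun u hu => by
      have := h.primal_le hf hg hu
      linarith
    convert h4 using 1
    simp
    abel
  · simpa using h.isSubgradient_conj hf hg

end Saddle

/-! ### Bounds for the feasibility and optimality gaps. -/

section Gap

variable {E F : Type*}
  [NormedAddCommGroup E] [InnerProductSpace ℝ E] [CompleteSpace E]
  [NormedAddCommGroup F] [InnerProductSpace ℝ F] [CompleteSpace F]
  {f : E → EReal} {f₂ : E → ℝ} {g : F → EReal} {A : E →L[ℝ] F} {L : ℝ≥0} {r δ : ℝ}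
  {x xbar : ℕ → E} {y : ℕ → F} {τ σ : ℕ → ℝ} {s : ℕ → ℕ} {xs : E} {ys : F}

/-- The point of `dom g` at which the dual proximal step attains the conjugate. -/
noncomputable def dualPoint (A : E →L[ℝ] F) (xbar : ℕ → E) (y : ℕ → F) (σ : ℕ → ℝ) (k : ℕ) : F :=
  (σ k)⁻¹ • (y k - y (k + 1)) + A (xbar (k + 1))

namespace IsAdmissibleRun

variable (H : IsAdmissibleRun f f₂ g A L r δ x xbar y τ σ s)

include H

theorem isSubgradient_dualPoint (k : ℕ) :
    IsSubgradient g (dualPoint A xbar y σ k) (y (k + 1)) :=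
  (H.isStep k).dual.of_fenchelConj H.proper_right

theorem norm_dualPoint_sub (k : ℕ) :
    ‖dualPoint A xbar y σ k - A (xbar (k + 1))‖ = (σ k)⁻¹ * ‖y (k + 1) - y k‖ := by
  rw [dualPoint, add_sub_cancel_right, norm_smul, Real.norm_of_nonneg (inv_pos.2 (H.sigma_pos k)).le,
    norm_sub_rev]

theorem norm_dualPoint_sub_le (k : ℕ) : ‖dualPoint A xbar y σ k - A (xbar (k + 1))‖ ≤
    √(sqResidual x y τ σ k * r ^ numChanges s k / σ 0) := by
  have hσ := H.sigma_pos k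
  refine Real.le_sqrt_of_sq_le ?_
  rw [H.norm_dualPoint_sub, mul_pow, le_div_iff₀ H.run.sigma_pos]
  have h1 : ‖y (k + 1) - y k‖ ^ 2 / σ k ≤ sqResidual x y τ σ k := by
    rw [sqResidual, sqNormV]
    exact le_add_of_nonneg_left (div_nonneg (sq_nonneg _) (H.tau_pos k).le)
  have h2 := mul_le_mul h1 (H.sigma_zero_le k) H.run.sigma_pos.le (H.sqResidual_nonneg k)
  have h3 := mul_le_mul_of_nonneg_right h2 (inv_pos.2 hσ).le
  have e1 : ‖y (k + 1) - y k‖ ^ 2 / σ k * σ 0 * (σ k)⁻¹ =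
      (σ k)⁻¹ ^ 2 * ‖y (k + 1) - y k‖ ^ 2 * σ 0 := by field_simp
  have e2 : sqResidual x y τ σ k * (r ^ numChanges s k * σ k) * (σ k)⁻¹ =
      sqResidual x y τ σ k * r ^ numChanges s k := by field_simp
  linarith

/-- x_* minimizes f + f₂ + ⟨A·, y_*⟩ and y_* ∈ ∂g(A x_*); adding the two inequalities leaves only
⟨y_*, v_k - A x̄_{k+1}⟩ as error. -/
theorem gap_dualPoint_ge (hs : IsSaddlePoint f f₂ g A xs ys) (k : ℕ) :
    (f xs).toReal + f₂ xs + (g (A xs)).toReal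
        - ‖ys‖ * ‖dualPoint A xbar y σ k - A (xbar (k + 1))‖ ≤
      (f (xbar (k + 1))).toReal + f₂ (xbar (k + 1)) + (g (dualPoint A xbar y σ k)).toReal := by
  have h1 := hs.primal_le H.proper_left H.proper_right (H.isStep k).primal.1
  have h2 := ((hs.isSubgradient_conj H.proper_left H.proper_right).of_fenchelConj
    H.proper_right).2 _ (H.isSubgradient_dualPoint k).1
  have h3 := neg_le_of_abs_le (abs_real_inner_le_norm ys (dualPoint A xbar y σ k - A (xbar (k + 1))))
  rw [inner_sub_right] at h2 h3
  rw [real_inner_comm, real_inner_comm ys (A (xbar (k + 1)))] at h1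
  linarith

/-- The subgradient inequalities at x̄_{k+1} and v_k are tested at x_* and A x_*. The smooth part
contributes 2R_k through the descent lemma, the mixed primal product another 2R_k, and the primal
and dual products with the distance to the saddle point one square root each. -/
theorem gap_dualPoint_le (hs : IsSaddlePoint f f₂ g A xs ys) (k : ℕ) :
    (f (xbar (k + 1))).toReal + f₂ (xbar (k + 1)) + (g (dualPoint A xbar y σ k)).toReal ≤
      (f xs).toReal + f₂ xs + (g (A xs)).toReal
        + ‖ys‖ * ‖dualPoint A xbar y σ k - A (xbar (k + 1))‖
        + 4 * sqResidual x y τ σ k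
        + 2 * √(sqResidual x y τ σ k * sqNormV (τ k) (σ k) (x k - xs) (y k - ys)) := by
  have hτ := H.tau_pos k
  have hσ := H.sigma_pos k
  have hgs := (hs.isSubgradient_conj H.proper_left H.proper_right).of_fenchelConj H.proper_right
  have h1 := (H.isStep k).primal.2 xs hs.1
  have h2 := (H.isSubgradient_dualPoint k).2 (A xs) hgs.1
  have h3 := add_inner_gradient_le H.convex H.diff (x k) xs
  have h4 := le_add_inner_gradient_add H.diff H.lip (x k) (xbar (k + 1))
  have hRx : ‖x k - x (k + 1)‖ ^ 2 / τ k ≤ sqResidual x y τ σ k := by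
    rw [sqResidual, sqNormV, norm_sub_rev]
    exact le_add_of_nonneg_right (by positivity)
  have hRy : ‖y k - y (k + 1)‖ ^ 2 / σ k ≤ sqResidual x y τ σ k := by
    rw [sqResidual, sqNormV, norm_sub_rev (y k)]
    exact le_add_of_nonneg_left (by positivity)
  have hDx : ‖x k - xs‖ ^ 2 / τ k ≤ sqNormV (τ k) (σ k) (x k - xs) (y k - ys) := by
    rw [sqNormV]
    exact le_add_of_nonneg_right (by positivity)
  have hDy : ‖y k - ys‖ ^ 2 / σ k ≤ sqNormV (τ k) (σ k) (x k - xs) (y k - ys) := by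
    rw [sqNormV]
    exact le_add_of_nonneg_left (by positivity)
  have hxb := H.norm_xbar_sub_sq_div_le k
  have h5 := inner_div_le_sqrt hτ hRx hDx
  have h6 := inner_div_le_sqrt hσ hRy hDy
  have h7 : ⟪x k - x (k + 1), xbar (k + 1) - x k⟫_ℝ / τ k ≤ 2 * sqResidual x y τ σ k := by
    have h8 : ⟪x k - x (k + 1), xbar (k + 1) - x k⟫_ℝ ≤
        (‖x k - x (k + 1)‖ ^ 2 + ‖xbar (k + 1) - x k‖ ^ 2) / 2 := by
      have := real_inner_le_norm (x k - x (k + 1)) (xbar (k + 1) - x k)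
      nlinarith [sq_nonneg (‖x k - x (k + 1)‖ - ‖xbar (k + 1) - x k‖)]
    have h9 := div_le_div_of_nonneg_right h8 hτ.le
    rw [div_right_comm, add_div] at h9
    linarith [H.sqResidual_nonneg k]
  have h8 : (L : ℝ) / 2 * ‖xbar (k + 1) - x k‖ ^ 2 ≤ 2 * sqResidual x y τ σ k := by
    have e : (L : ℝ) / 2 * ‖xbar (k + 1) - x k‖ ^ 2 =
        τ k * L / 2 * (‖xbar (k + 1) - x k‖ ^ 2 / τ k) := by field_simp
    rw [e]
    have h9 := mul_le_mul_of_nonneg_right (show τ k * L / 2 ≤ 1 by linarith [H.tau_lt k])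
      (show 0 ≤ ‖xbar (k + 1) - x k‖ ^ 2 / τ k by positivity)
    linarith
  have h9 : -⟪ys, (σ k)⁻¹ • (y (k + 1) - y k)⟫_ℝ ≤
      ‖ys‖ * ‖dualPoint A xbar y σ k - A (xbar (k + 1))‖ := by
    have e : dualPoint A xbar y σ k - A (xbar (k + 1)) = -((σ k)⁻¹ • (y (k + 1) - y k)) := by
      rw [dualPoint, add_sub_cancel_right, ← smul_neg, neg_sub]
    rw [← inner_neg_right, e]
    exact real_inner_le_norm _ _
  have e1 : ⟪(τ k)⁻¹ • (x k - xbar (k + 1)) - gradient f₂ (x k) - A.adjoint (y k),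
        xs - xbar (k + 1)⟫_ℝ =
      -(⟪x k - x (k + 1), xbar (k + 1) - x k⟫_ℝ / τ k) - ⟪x k - x (k + 1), x k - xs⟫_ℝ / τ k
        - (⟪gradient f₂ (x k), xs - x k⟫_ℝ - ⟪gradient f₂ (x k), xbar (k + 1) - x k⟫_ℝ)
        - (⟪y (k + 1), A xs⟫_ℝ - ⟪y (k + 1), A (xbar (k + 1))⟫_ℝ) := by
    -- The correction in the x-update replaces A^⊤y_k by A^⊤y_{k+1}, so the bilinear terms cancel
    -- against those of the dual inequality.
    have e2 : (τ k)⁻¹ • (x k - xbar (k + 1)) - gradient f₂ (x k) - A.adjoint (y k) =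
        (τ k)⁻¹ • (x k - x (k + 1)) - gradient f₂ (x k) - A.adjoint (y (k + 1)) := by
      rw [H.run.x_step k]
      simp only [smul_sub, inv_smul_smul₀ hτ.ne', map_sub]
      abel
    rw [e2, inner_sub_left, inner_sub_left, ContinuousLinearMap.adjoint_inner_left, map_sub,
      inner_sub_right (y (k + 1)), inner_smul_left,
      show xs - xbar (k + 1) = -(xbar (k + 1) - x k) - (x k - xs) by abel,
      show xs - x k = -(x k - xs) by abel]
    simp only [inner_sub_right (x k - x (k + 1)), inner_neg_right,
      inner_sub_right (gradient f₂ (x k)) (-(xbar (k + 1) - x k)), conj_trivial]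
    ring
  have e3 : ⟪y (k + 1), A xs - dualPoint A xbar y σ k⟫_ℝ =
      ⟪y (k + 1), A xs⟫_ℝ - ⟪y (k + 1), A (xbar (k + 1))⟫_ℝ
        + ‖y (k + 1) - y k‖ ^ 2 / σ k - ⟪y k - y (k + 1), y k - ys⟫_ℝ / σ k
        + ⟪ys, (σ k)⁻¹ • (y (k + 1) - y k)⟫_ℝ := by
    rw [dualPoint, inner_sub_right, inner_add_right, inner_smul_right, inner_smul_right,
      ← real_inner_self_eq_norm_sq, div_eq_inv_mul, div_eq_inv_mul]
    simp only [inner_sub_left, inner_sub_right]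
    rw [real_inner_comm (y k) (y (k + 1)), real_inner_comm (y k) ys,
      real_inner_comm (y (k + 1)) ys]
    ring
  have h10 : 0 ≤ ‖y (k + 1) - y k‖ ^ 2 / σ k := by positivity
  linarith

/-- The bound for both gaps in terms of the rescaled residual `ε`. -/
theorem abs_gap_le (hs : IsSaddlePoint f f₂ g A xs ys) {M : ℝ≥0}
    (hM : LipschitzOnWith M (fun v => (g v).toReal) (effDom g)) {w : F} {k : ℕ}
    (hw : IsProj (effDom g) (A (xbar (k + 1))) w) {ε : ℝ}
    (hε : ε = sqResidual x y τ σ k * r ^ numChanges s k) :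
    |(f (xbar (k + 1))).toReal + f₂ (xbar (k + 1)) + (g w).toReal
        - ((f xs).toReal + f₂ xs + (g (A xs)).toReal)| ≤
      (‖ys‖ + 2 * M) * √(ε / σ 0) + 4 * ε
        + 2 * √(ε * sqNormV (τ 0) (σ 0) (x 0 - xs) (y 0 - ys)) := by
  have hR := H.sqResidual_nonneg k
  have h1 := H.gap_dualPoint_ge hs k
  have h2 := H.gap_dualPoint_le hs k
  have hN := H.norm_dualPoint_sub_le k
  rw [← hε] at hN
  set v := dualPoint A xbar y σ k with hv
  have hvd : v ∈ effDom g := (H.isSubgradient_dualPoint k).1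
  have hgw : |(g w).toReal - (g v).toReal| ≤ 2 * M * √(ε / σ 0) := by
    -- As v lies in dom g, the projection w is no farther from A x̄_{k+1} than v is; hence the
    -- factor 2 in the distance from w to v.
    have h3 := hM.dist_le_mul w hw.1 v hvd
    have h4 : dist w v ≤ 2 * √(ε / σ 0) := by
      have h5 := dist_triangle_left w v (A (xbar (k + 1)))
      have h6 := Metric.infDist_le_dist_of_mem (x := A (xbar (k + 1))) hvd
      rw [← hw.2] at h6
      rw [dist_comm _ v, dist_eq_norm v (A _)] at h6
      rw [dist_comm (A _) v, dist_eq_norm v (A _)] at h5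
      linarith
    rw [Real.dist_eq] at h3
    have h5 := mul_le_mul_of_nonneg_left h4 M.coe_nonneg
    linarith
  have hys := mul_le_mul_of_nonneg_left hN (norm_nonneg ys)
  have hRε : sqResidual x y τ σ k ≤ ε :=
    hε ▸ le_mul_of_one_le_right hR (one_le_pow₀ H.one_lt.le)
  have hRD : √(sqResidual x y τ σ k * sqNormV (τ k) (σ k) (x k - xs) (y k - ys)) ≤
      √(ε * sqNormV (τ 0) (σ 0) (x 0 - xs) (y 0 - ys)) := by
    refine Real.sqrt_le_sqrt ?_
    have h3 := mul_le_mul_of_nonneg_left (H.sqNormV_sub_saddle_le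
      (hs.isStep H.proper_left H.proper_right H.diff) k) hR
    rw [hε]
    linarith
  have h0 : 0 ≤ √(ε * sqNormV (τ 0) (σ 0) (x 0 - xs) (y 0 - ys)) := Real.sqrt_nonneg _
  obtain ⟨h3, h4⟩ := abs_le.1 hgw
  rw [abs_le]
  constructor <;> linarith

end IsAdmissibleRun

end Gap

end TriPD

theorem theorem1 (n m : ℕ)
    (f : EuclideanSpace ℝ (Fin n) → EReal) (f₂ : EuclideanSpace ℝ (Fin n) → ℝ)
    (g : EuclideanSpace ℝ (Fin m) → EReal)
    (A : EuclideanSpace ℝ (Fin n) →L[ℝ] EuclideanSpace ℝ (Fin m))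
    (Lf M : ℝ≥0) (r δ : ℝ)
    (xs : EuclideanSpace ℝ (Fin n)) (ys : EuclideanSpace ℝ (Fin m))
    (x xbar : ℕ → EuclideanSpace ℝ (Fin n)) (y : ℕ → EuclideanSpace ℝ (Fin m))
    (τ σ : ℕ → ℝ) (s : ℕ → ℕ)
    (hf : TriPD.IsProperConvexLsc f) (hg : TriPD.IsProperConvexLsc g)
    (hf₂ : ConvexOn ℝ Set.univ f₂) (hf₂_diff : Differentiable ℝ f₂)
    (hf₂_lip : LipschitzWith Lf (gradient f₂))
    (hg_lip : LipschitzOnWith M (fun v => (g v).toReal) (TriPD.effDom g))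
    (hsaddle : TriPD.IsSaddlePoint f f₂ g A xs ys)
    (hr : 1 < r) (hδ : 0 < δ) (hδr : δ * r < 1)
    (hrun : TriPD.IsAdaptiveRun f f₂ g A r δ x xbar y τ σ s)
    (hστ : σ 0 * τ 0 * ‖A‖ ^ 2 < 1)
    (hτ : ∀ k, τ k * Lf < 2) :
    Tendsto (fun k => Metric.infDist (A (xbar (k + 1))) (TriPD.effDom g)) atTop (𝓝 0) ∧
    ∃ w : ℕ → EuclideanSpace ℝ (Fin m),
      (∀ k, TriPD.IsProj (TriPD.effDom g) (A (xbar (k + 1))) (w k)) ∧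
      Tendsto
        (fun k => TriPD.objective f f₂ g (xbar (k + 1)) (w k) - TriPD.objective f f₂ g xs (A xs))
        atTop (𝓝 (0 : EReal)) := by
  have H : TriPD.IsAdmissibleRun f f₂ g A Lf r δ x xbar y τ σ s :=
    ⟨hf, hg, ⟨ys, hsaddle.2.1⟩, hf₂, hf₂_diff, hf₂_lip, hr, hδ, hδr, hrun, hστ, hτ⟩
  have hε := H.tendsto_sqResidual_mul (hsaddle.isStep hf hg hf₂_diff)
  have hsqrt : Tendsto
      (fun k => √(TriPD.sqResidual x y τ σ k * r ^ TriPD.numChanges s k / σ 0)) atTop (𝓝 0) := by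
    simpa using (hε.div_const (σ 0)).sqrt
  refine ⟨squeeze_zero (fun _ => Metric.infDist_nonneg) (fun k => ?_) hsqrt, ?_⟩
  · refine (Metric.infDist_le_dist_of_mem (H.isSubgradient_dualPoint k).1).trans ?_
    rw [dist_comm, dist_eq_norm]
    exact H.norm_dualPoint_sub_le k
  · choose w hwmem hwdist using fun k => (TriPD.isClosed_effDom hg hg_lip).exists_infDist_eq_dist
      hg.nonempty_dom (A (xbar (k + 1)))
    have hproj : ∀ k, TriPD.IsProj (TriPD.effDom g) (A (xbar (k + 1))) (w k) :=
      fun k => ⟨hwmem k, (hwdist k).symm⟩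
    refine ⟨w, hproj, ?_⟩
    have hgs := ((hsaddle.isSubgradient_conj hf hg).of_fenchelConj hg).1
    -- All values involved are finite, so the extended-real difference is a coerced real and
    -- convergence can be checked in ℝ.
    simp only [fun k => TriPD.objective_sub_objective (f₂ := f₂) hf hg (H.isStep k).primal.1
      (hwmem k) hsaddle.1 hgs]
    rw [← EReal.coe_zero, EReal.tendsto_coe]
    refine squeeze_zero_norm (fun k => H.abs_gap_le hsaddle hg_lip (hproj k) rfl) ?_
    have h1 := hsqrt.const_mul (‖ys‖ + 2 * M)
    have h2 := hε.const_mul 4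
    have h3 := ((hε.mul_const
      (TriPD.sqNormV (τ 0) (σ 0) (x 0 - xs) (y 0 - ys))).sqrt).const_mul 2
    simpa using (h1.add h2).add h3
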